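/- A tournament is a finite loopless digraph with exactly one arc between any two distinct vertices, and $p(T;S)$ denotes the probability that a uniformly random set of $|T|$ vertices of a tournament $S$ with $|S|\ge|T|$ induces a copy of $T$. Let $T_5^8$ be the strongly connected tournament on $\{0,1,2,3,4\}$ with arcs $01,12,23,34,40,02,03,13,14,42$. For a tournament $T$ of size $k$ put $\phi_{\mathrm{qr}}(T)=\frac{k!}{|\mathrm{Aut}(T)|\,2^{\binom{k}{2}}}$. Let $R_{n,1/2}$ be the random tournament on $n$ vertices in which each arc orientation is present with probability $1/2$, independently for the different pairs of vertices. (i) We have $$\lim_{n\to\infty}\max\{p(T_5^8;S) : S \text{ a tournament},\ |S|=n\}=\frac{15}{128}.$$ (ii) If $(T_n)_{n\in\mathbb N}$ is a sequence of tournaments with $|T_n|<|T_{n+1}|$ for all $n$, then $\lim_{n\to\infty}p(T_5^8;T_n)=15/128$ if and only if $(T_n)$ is quasi-random, that is, if and only if it converges to $\phi_{\mathrm{qr}}$: $\lim_{n\to\infty}p(T;T_n)=\phi_{\mathrm{qr}}(T)$ for every tournament $T$. (iii) Let $\mathcal A^0$ be the flag algebra of tournaments: the real vector space spanned by the isomorphism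 classes of tournaments modulo the relations $F=\sum_{|G|=\ell}p(F;G)\,G$ for $\ell\ge|F|$, with product $F_1F_2=\sum_{|G|=\ell}p(F_1,F_2;G)\,G$ for $\ell\ge|F_1|+|F_2|$, where $p(F_1,F_2;G)$ is the probability that a uniformly random pair of disjoint vertex sets of $G$ of sizes $|F_1|,|F_2|$ induces copies of $F_1$ and $F_2$ respectively, and with the empty tournament as unit. If $\phi:\mathcal A^0\to\mathbb R$ is an algebra homomorphism with $\phi(F)\in[0,1]$ for every tournament $F$, then $\phi(T_5^8)\le 15/128$, with equality if and only if $\phi=\phi_{\mathrm{qr}}$. (iv) $\phi_{\mathrm{qr}}$ is the almost sure limit of the random tournaments $R_{n,1/2}$: whatever the joint distribution of the $R_{n,1/2}$, $n\in\mathbb N$, on a common probability space, almost surely $\lim_{n\to\infty}p(T;R_{n,1/2})=\phi_{\mathrm{qr}}(T)$ for every tournament $T$. -/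

import Mathlib

open Filter Topology MeasureTheory ProbabilityTheory

/-- A tournament on `V`: a loopless digraph with exactly one arc between any two distinct
vertices. `T.Adj u v` says that `uv` is an arc. -/
@[ext]
structure Tournament (V : Type*) extends Digraph V where
  loopless : ∀ v, ¬ Adj v v
  exactly_one : ∀ u v, u ≠ v → (Adj u v ↔ ¬ Adj v u)

namespace Tournament

/-- The subtournament induced on a set of vertices. -/
def induce {V : Type*} (T : Tournament V) (A : Set V) : Tournament A where
  Adj u v := T.Adj u v
  loopless v := T.loopless v
  exactly_one u v h := T.exactly_one u v (fun e => h (Subtype.ext e))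

/-- Isomorphism of tournaments: a bijection of the vertices preserving and reflecting arcs. -/
def IsIso {V W : Type*} (T : Tournament V) (S : Tournament W) : Prop :=
  Nonempty (T.Adj ≃r S.Adj)

open Classical in
/-- The unlabelled density `p(T; S)`: the probability that a uniformly random set of `|T|`
vertices of `S` induces a copy of `T` (and `0` if `|T| > |S|`). -/
noncomputable def density {V W : Type*} [Fintype V] [Fintype W]
    (T : Tournament V) (S : Tournament W) : ℝ :=
  (((Finset.univ : Finset W).powersetCard (Fintype.card V)).filter
      (fun A => T.IsIso (S.induce (A : Set W)))).card /
    ((Fintype.card W).choose (Fintype.card V) : ℝ)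

open Classical in
/-- The joint density `p(F₁, F₂; G)`: the probability that a uniformly random pair of disjoint
vertex sets of `G` of sizes `|F₁|` and `|F₂|` induces a copy of `F₁` and a copy of `F₂`. -/
noncomputable def jointDensity {V₁ V₂ W : Type*} [Fintype V₁] [Fintype V₂] [Fintype W]
    (F₁ : Tournament V₁) (F₂ : Tournament V₂) (G : Tournament W) : ℝ :=
  let pairs : Finset (Finset W × Finset W) :=
    ((Finset.univ : Finset W).powersetCard (Fintype.card V₁) ×ˢ
      (Finset.univ : Finset W).powersetCard (Fintype.card V₂)).filter
        (fun A => Disjoint A.1 A.2)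
  ((pairs.filter (fun A => F₁.IsIso (G.induce (A.1 : Set W)) ∧
      F₂.IsIso (G.induce (A.2 : Set W)))).card : ℝ) / (pairs.card : ℝ)

/-- Isomorphism as an equivalence relation on the tournaments on `{0, …, n - 1}`. -/
instance isoSetoid (n : ℕ) : Setoid (Tournament (Fin n)) where
  r := IsIso
  iseqv := ⟨fun _ => ⟨RelIso.refl _⟩, fun ⟨e⟩ => ⟨e.symm⟩, fun ⟨e⟩ ⟨f⟩ => ⟨e.trans f⟩⟩

/-- The set of all tournaments of size `n` up to isomorphism. -/
def IsoClass (n : ℕ) : Type := Quotient (isoSetoid n)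

instance (n : ℕ) : Finite (Tournament (Fin n)) :=
  Finite.of_injective (fun T : Tournament (Fin n) => T.Adj) fun S T h => by
    cases S; cases T; congr; exact Digraph.ext h

noncomputable instance (n : ℕ) : Fintype (IsoClass n) :=
  @Fintype.ofFinite _ (inferInstanceAs (Finite (Quotient (isoSetoid n))))

/-- A chosen member of an isomorphism class. -/
noncomputable def IsoClass.rep {n : ℕ} (c : IsoClass n) : Tournament (Fin n) := Quotient.out c

/-- The strongly connected tournament `T₅⁸`: the oriented 5-cycle `0 → 1 → 2 → 3 → 4 → 0` with the
remaining pairs oriented `0 → 2`, `0 → 3`, `1 → 3`, `1 → 4`, `4 → 2`. -/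
def T58 : Tournament (Fin 5) where
  Adj i j := (i, j) ∈ ([(0, 1), (1, 2), (2, 3), (3, 4), (4, 0),
    (0, 2), (0, 3), (1, 3), (1, 4), (4, 2)] : List (Fin 5 × Fin 5))
  loopless := by decide
  exactly_one := by decide

/-- The sequence `T` converges to the family of numbers `φ`: `p(F; T n) → φ(F)` for every finite
tournament `F`. -/
def ConvergesTo {s : ℕ → ℕ} (T : ∀ n, Tournament (Fin (s n)))
    (φ : ∀ k, Tournament (Fin k) → ℝ) : Prop :=
  ∀ (k : ℕ) (F : Tournament (Fin k)),
    Tendsto (fun n => density F (T n)) atTop (𝓝 (φ k F))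

/-- The quasi-random homomorphism, `φ_qr(F) = k! / (|Aut F| * 2 ^ (k choose 2))` where
`k = |F|`. -/
noncomputable def phiQR (k : ℕ) (F : Tournament (Fin k)) : ℝ :=
  (k.factorial : ℝ) / ((Nat.card (F.Adj ≃r F.Adj) : ℝ) * 2 ^ k.choose 2)

/-- The positive homomorphisms `Hom⁺(𝒜⁰, ℝ)` of the flag algebra of tournaments, given by their
values on tournaments. The algebra `𝒜⁰` is the real vector space spanned by the isomorphism classes
of tournaments modulo the relations `F = ∑_{G of size l} p(F; G) G` for `l ≥ |F|`, with product
`F₁ F₂ = ∑_{G of size l} p(F₁, F₂; G) G` for `l ≥ |F₁| + |F₂|` and with the empty tournament as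
unit; so its algebra homomorphisms to `ℝ` are the linear extensions of the isomorphism-invariant
functions that respect these relations, the product and the unit. Positivity means that all
tournaments have values in `[0, 1]`. -/
structure IsPosHom (φ : ∀ k, Tournament (Fin k) → ℝ) : Prop where
  map_iso : ∀ (k : ℕ) (F G : Tournament (Fin k)), F.IsIso G → φ k F = φ k G
  map_rel : ∀ (k l : ℕ) (F : Tournament (Fin k)), k ≤ l →
    φ k F = ∑ c : IsoClass l, density F c.rep * φ l c.rep
  map_one : ∀ F : Tournament (Fin 0), φ 0 F = 1
  map_mul : ∀ (k₁ k₂ l : ℕ) (F₁ : Tournament (Fin k₁)) (F₂ : Tournament (Fin k₂)), k₁ + k₂ ≤ l →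
    φ k₁ F₁ * φ k₂ F₂ = ∑ c : IsoClass l, jointDensity F₁ F₂ c.rep * φ l c.rep
  mem_Icc : ∀ (k : ℕ) (F : Tournament (Fin k)), φ k F ∈ Set.Icc (0 : ℝ) 1

/-- `R` is the random tournament `R_{n,1/2}`: each arc orientation is present with probability
`1/2`, independently for the different pairs of vertices. -/
structure IsRandomTournament {Ω : Type*} [MeasurableSpace Ω] (P : Measure Ω) {n : ℕ}
    (R : Ω → Tournament (Fin n)) : Prop where
  measurable_arc : ∀ i j : Fin n, MeasurableSet {ω | (R ω).Adj i j}
  prob_arc : ∀ i j : Fin n, i ≠ j → P {ω | (R ω).Adj i j} = 1 / 2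
  indep : iIndepSet (fun e : {e : Fin n × Fin n // e.1 < e.2} =>
    {ω | (R ω).Adj e.1.1 e.1.2}) P

end Tournament

/-!
Write `f(x, y) = ±1` for the sign of the pair `xy` in a tournament with `n` vertices
(`Tournament.sgn`), and let the energy `∑ f(x,u) f(y,u) f(x,v) f(y,v)` be the signed count of closed
walks of length four. Everything rests on comparing the scaled energy `t = energy / n ^ 4` with the
densities.

The certificate. As `T₅⁸` has only the trivial automorphism, its density is
`120 / 2 ^ 10 = 15 / 128` times the average `E`, over the tuples of five distinct vertices, of the
product of `1 + f` over the ten pairs that are to be the arcs of a copy. A semidefinite certificate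
shows that `45 (1 - E)` is, up to `O(1 / n)`, an average of nonnegative terms containing `27 t`. The
other terms are squares of linear forms in a further vertex `u` relative to a transitive triple
`x → y → z`, such as `3 f(x,u) + 3 f(z,u) - f(x,u) f(y,u) + f(y,u) f(z,u) - 5 f(x,u) f(y,u) f(z,u)`,
squares of similar forms relative to a cyclic triple, and squares of sums of signs, products of
signs and codegrees. The identity behind this holds after averaging over the `5!` relabellings of
each tournament on five vertices. By invariance and the existence of Hamiltonian paths, only `64`
such tournaments have to be checked (`sum_listDefect`, `sum_injective_tupleDefect`). The resulting
inequality is `density_T58_le`: the density of `T₅⁸` is at most `15 / 128 - 9 / 128 * t + O(1 / n)`.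

The counting lemma. Expanding the product of the factors `(1 ± f) / 2` over all pairs, and bounding
each nonconstant term with the Cauchy–Schwarz inequality, every density differs from its
quasi-random value by `O(t ^ (1 / 4) + 1 / n)` (`abs_density_sub_phiQR_le`). Together with the
certificate this gives stability (`exists_abs_density_sub_phiQR_le`): all densities are controlled
by the defect of the density of `T₅⁸` from `15 / 128`, and up to an arbitrarily small error the
control is linear in that defect.

The consequences. Stability settles sequences of tournaments directly. The value of a positive
homomorphism on `F` is the average of the density of `F` in a random tournament of size `l`, and the
linear stability estimate survives averaging. Finally, reversing one arc shows that the
nondegenerate terms of the energy of a uniformly random tournament are nearly uncorrelated, so that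
their sum has second moment `O(n ^ 4)` (`sum_mainEnergy_sq_le`). Hence some tournaments have small
energy, which makes the bound `15 / 128` sharp, and by summability of the scaled second moments the
random tournaments are almost surely quasi-random.
-/

namespace Tournament

/-! ### Signs of arcs -/

section Sign

variable {V : Type*} (T : Tournament V)

open Classical in
/-- The skew-symmetric `±1` matrix of a tournament: `1` on an arc `xy`, `-1` on the reverse of an
arc, and `0` on the diagonal. -/
noncomputable def sgn (x y : V) : ℝ := if T.Adj x y then 1 else if T.Adj y x then -1 else 0

variable {T}

lemma adj_asymm {x y : V} (h : T.Adj x y) : ¬ T.Adj y x := by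
  by_cases e : x = y
  · subst e; exact T.loopless x
  · exact (T.exactly_one x y e).1 h

lemma adj_of_not_adj {x y : V} (hne : x ≠ y) (h : ¬ T.Adj x y) : T.Adj y x := by
  by_contra h'
  exact h ((T.exactly_one x y hne).2 h')

lemma sgn_of_adj {x y : V} (h : T.Adj x y) : T.sgn x y = 1 := by simp [sgn, h]

lemma sgn_of_adj_symm {x y : V} (h : T.Adj y x) : T.sgn x y = -1 := by
  simp [sgn, h, adj_asymm h]

@[simp] lemma sgn_self (x : V) : T.sgn x x = 0 := by simp [sgn, T.loopless x]

lemma sgn_symm (x y : V) : T.sgn y x = - T.sgn x y := by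
  by_cases e : x = y
  · subst e; simp
  by_cases h : T.Adj x y
  · rw [sgn_of_adj h, sgn_of_adj_symm h]
  · have := adj_of_not_adj e h
    rw [sgn_of_adj this, sgn_of_adj_symm this]; ring

lemma abs_sgn_le (x y : V) : |T.sgn x y| ≤ 1 := by
  unfold sgn; split_ifs <;> simp

open Classical in
lemma sgn_eq_ite {x y : V} (h : x ≠ y) : T.sgn x y = if T.Adj x y then 1 else -1 := by
  split_ifs with h'
  · exact sgn_of_adj h'
  · exact sgn_of_adj_symm (adj_of_not_adj h h')

lemma sgn_eq_iff {W : Type*} {S : Tournament W} {x y : V} {a b : W} (h : x ≠ y) (h' : a ≠ b) :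
    T.sgn x y = S.sgn a b ↔ (T.Adj x y ↔ S.Adj a b) := by
  rw [sgn_eq_ite h, sgn_eq_ite h']
  by_cases p : T.Adj x y <;> by_cases q : S.Adj a b <;> simp [p, q] <;> norm_num

end Sign

/-! ### Densities and labelled copies -/

section Density

variable {V W : Type*} [Fintype V] [Fintype W] (F : Tournament V) (S : Tournament W)

/-- Labelled copies of `F` with vertex set `A` are the isomorphisms of `F` with the subtournament
induced on `A`. -/
noncomputable def embeddingsOntoEquiv (A : Finset W) :
    {e : F.Adj ↪r S.Adj // Finset.univ.map e.toEmbedding = A} ≃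
      (F.Adj ≃r (S.induce (A : Set W)).Adj) where
  toFun e :=
    { toEquiv := Equiv.ofBijective (fun u => ⟨e.1 u, by
          exact (Finset.ext_iff.1 e.2 _).1 (by simp)⟩) (by
        constructor
        · intro u v h
          exact e.1.injective (congrArg Subtype.val h)
        · rintro ⟨w, hw⟩
          obtain ⟨u, -, hu⟩ := Finset.mem_map.1 ((Finset.ext_iff.1 e.2 _).2 hw)
          exact ⟨u, Subtype.ext hu⟩)
      map_rel_iff' := by
        intro a b
        exact e.1.map_rel_iff }
  invFun i := ⟨⟨⟨fun u => (i u : W), fun u v h => i.injective (Subtype.ext h)⟩, by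
      intro a b
      exact i.map_rel_iff⟩, by
      ext w
      simp only [Finset.mem_map, Finset.mem_univ, true_and]
      constructor
      · rintro ⟨u, rfl⟩
        exact (i u).2
      · intro hw
        exact ⟨i.symm ⟨w, hw⟩, by
          change ((i (i.symm ⟨w, hw⟩) : _) : W) = w
          rw [RelIso.apply_symm_apply]⟩⟩
  left_inv e := by ext; rfl
  right_inv i := by ext; rfl

open Classical in
/-- The monadic coercion inside `density` only turns the vertex sets, as finsets, into sets, so the
copies may be counted as finsets. -/
lemma density_eq_card_finset :
    F.density S = (((Finset.univ : Finset W).powersetCard (Fintype.card V)).filter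
      (fun A : Finset W => F.IsIso (S.induce (A : Set W)))).card /
        ((Fintype.card W).choose (Fintype.card V) : ℝ) := by
  unfold density
  congr 2
  rw [← Finset.card_image_of_injective _ (Finset.coe_injective (α := W))]
  congr 1
  ext B
  simp only [Finset.mem_filter, Finset.bind_def, Finset.pure_def, Finset.mem_sup,
    Finset.mem_singleton, Finset.mem_image]
  constructor
  · rintro ⟨⟨A, hA, rfl⟩, h⟩
    exact ⟨A, ⟨hA, h⟩, rfl⟩
  · rintro ⟨A, ⟨hA, h⟩, rfl⟩
    exact ⟨⟨A, hA, rfl⟩, h⟩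

/-- Each unlabelled copy of `F` carries `|Aut F|` labelled ones. -/
lemma density_mul_card_aut :
    F.density S * (Nat.card (F.Adj ≃r F.Adj) * (Fintype.card W).choose (Fintype.card V)) =
      Nat.card (F.Adj ↪r S.Adj) := by
  classical
  have key : Nat.card (F.Adj ↪r S.Adj) =
      (((Finset.univ : Finset W).powersetCard (Fintype.card V)).filter
      (fun A : Finset W => F.IsIso (S.induce (A : Set W)))).card * Nat.card (F.Adj ≃r F.Adj) := by
    rw [Nat.card_congr (Equiv.sigmaFiberEquiv
      (fun e : F.Adj ↪r S.Adj => (Finset.univ.map e.toEmbedding : Finset W))).symm]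
    have : Finite (F.Adj ↪r S.Adj) := Finite.of_injective _ RelEmbedding.toEmbedding_injective
    rw [Nat.card_sigma, Finset.card_eq_sum_ones, Finset.sum_mul, one_mul]
    refine Eq.trans (Finset.sum_subset (Finset.subset_univ (Finset.filter _ _)) ?_).symm
      (Finset.sum_congr rfl ?_)
    rotate_left
    · intro A hA
      obtain ⟨i⟩ := (Finset.mem_filter.1 hA).2
      rw [Nat.card_congr (embeddingsOntoEquiv F S A)]
      exact Nat.card_congr
        ⟨fun e => e.trans i.symm, fun e => e.trans i, fun e => by ext; simp, fun e => by ext; simp⟩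
    · intro A _ hA
      rw [Nat.card_eq_zero]
      left
      refine ⟨fun e => hA ?_⟩
      rw [Finset.mem_filter, Finset.mem_powersetCard]
      refine ⟨⟨Finset.subset_univ _, ?_⟩, ⟨embeddingsOntoEquiv F S A e⟩⟩
      rw [← e.2, Finset.card_map, Finset.card_univ]
  rw [key]
  by_cases h : (Fintype.card W).choose (Fintype.card V) = 0
  · have : ((Finset.univ : Finset W).powersetCard (Fintype.card V)) = ∅ := by
      rw [← Finset.card_eq_zero, Finset.card_powersetCard, Finset.card_univ, h]
    simp [h, this]
  · have : ((Fintype.card W).choose (Fintype.card V) : ℝ) ≠ 0 := by exact_mod_cast h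
    rw [density_eq_card_finset]
    push_cast
    field_simp

instance (F : Tournament V) : Finite (F.Adj ≃r F.Adj) :=
  Finite.of_injective (fun e => e.toEquiv) RelIso.toEquiv_injective

lemma card_aut_pos : 0 < Nat.card (F.Adj ≃r F.Adj) :=
  Nat.card_pos_iff.2 ⟨⟨RelIso.refl _⟩, inferInstance⟩

end Density

/-- The density in terms of the probability that a random injection is a labelled copy. -/
lemma density_eq {V : Type*} [Fintype V] {k : ℕ} (F : Tournament (Fin k)) (S : Tournament V)
    (h : k ≤ Fintype.card V) :
    F.density S = (k.factorial / Nat.card (F.Adj ≃r F.Adj) : ℝ) *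
      ((Nat.card (F.Adj ↪r S.Adj) : ℝ) / (Fintype.card V).descFactorial k) := by
  have h1 := density_mul_card_aut F S
  rw [Fintype.card_fin] at h1
  have h2 : (0 : ℝ) < Nat.card (F.Adj ≃r F.Adj) := by exact_mod_cast card_aut_pos F
  have h3 : (0 : ℝ) < (Fintype.card V).choose k := by exact_mod_cast Nat.choose_pos h
  have h4 : (0 : ℝ) < k.factorial := by exact_mod_cast k.factorial_pos
  rw [← h1, Nat.descFactorial_eq_factorial_mul_choose]
  push_cast
  field_simp


/-! ### The certificate on five vertices -/

/-- The sign of an arc, given by whether it is present. -/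
def boolSign (b : Bool) : ℤ := cond b 1 (-1)

/-- The linear form of the certificate attached to a transitive triple; `a`, `b`, `c` are the signs
of the arcs from its source, middle and sink to a further vertex. -/
def transForm (a b c : ℤ) : ℤ := 3 * a + 3 * c - a * b + b * c - 5 * (a * b * c)

/-- The bilinear form of the certificate attached to a cyclic triple. -/
def cycForm (a b c a' b' c' : ℤ) : ℤ :=
  32 * ((a + b + c + 5 * (a * b * c)) * (a' + b' + c' + 5 * (a' * b' * c')) +
    (a * b + b * c + c * a) * (a' * b' + b' * c' + c' * a')) +
    240 * (a * b * (a' * b') + b * c * (b' * c') + c * a * (c' * a'))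

/-- The defect of the certificate on five vertices `x, y, z, u, v` whose arcs are given by
booleans: `45 - 46080 [labelled copy of T₅⁸]` minus the terms that become squares after summation
over all tuples. Here `46080 = 45 * 2 ^ 10`, so that the first two terms cancel on average for
quasi-random tournaments. -/
def defect (xy xz yz xu yu zu xv yv zv uv : Bool) : ℤ :=
  45 - cond (xy && yz && zu && uv && !xv && xz && xu && yu && yv && !zv) 46080 0
  - cond (xy && yz && xz) (24 * (transForm (boolSign xu) (boolSign yu) (boolSign zu) *
      transForm (boolSign xv) (boolSign yv) (boolSign zv))) 0
  - cond (xy && yz && !xz) (cycForm (boolSign xu) (boolSign yu) (boolSign zu)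
      (boolSign xv) (boolSign yv) (boolSign zv)) 0
  - 24 * (boolSign xu * boolSign xv)
  - 93 * (boolSign xy * boolSign xz * boolSign xu * boolSign xv)
  - 27 * (boolSign xu * boolSign yu * boolSign xv * boolSign yv)
  - 24 * (boolSign xu * boolSign yu * boolSign yv * boolSign zv)
  - 11 * (boolSign xu * boolSign yu * boolSign zu * boolSign xv * boolSign yv * boolSign zv)

/-- The defect of a relabelling `l` of the tournament on `0, …, 4` with arcs `b`. -/
def listDefect (b : ℕ → ℕ → Bool) (l : List ℕ) : ℤ := match l with
  | [x, y, z, u, v] => defect (b x y) (b x z) (b y z) (b x u) (b y u) (b z u) (b x v) (b y v)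
      (b z v) (b u v)
  | _ => 0

/-- All ways to insert `a` into a list. -/
def insertions (a : ℕ) : List ℕ → List (List ℕ)
  | [] => [[a]]
  | b :: l => (a :: b :: l) :: (insertions a l).map (b :: ·)

/-- The `120` arrangements of `0, …, 4`. -/
def arrangements : List (List ℕ) :=
  [4, 3, 2, 1, 0].foldr (fun a L => L.flatMap (insertions a)) [[]]

/-- The arcs, on the vertices `0, …, 4`, of the tournament with the path `0 → 1 → 2 → 3 → 4` whose
remaining arcs are given by booleans. The pair `i < j` is read off at the binary digit
`j (j - 1) / 2 + i`. -/
def pathArc (m : ℕ) (i j : ℕ) : Bool :=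
  bif Nat.blt i j then m.testBit (j * (j - 1) / 2 + i) else !m.testBit (i * (i - 1) / 2 + j)

/-- The binary digits of the tournament with the path `0 → 1 → 2 → 3 → 4` and the given remaining
arcs; the path contributes `2 ^ 0 + 2 ^ 2 + 2 ^ 5 + 2 ^ 9 = 549`. -/
def pathCode (b02 b03 b13 b04 b14 b24 : Bool) : ℕ :=
  549 + (cond b02 2 0 + cond b03 8 0 + cond b13 16 0 + cond b04 64 0 + cond b14 128 0 +
    cond b24 256 0)

lemma pathArc_symm (m : ℕ) {i j : ℕ} (h : i ≠ j) : pathArc m j i = !pathArc m i j := by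
  unfold pathArc
  rcases lt_or_gt_of_ne h with h | h
  · have h1 : Nat.blt i j = true := by simpa [Nat.blt_eq] using h
    have h2 : Nat.blt j i = false := by
      rw [Bool.eq_false_iff]; simp [Nat.blt_eq]; omega
    rw [h1, h2]; rfl
  · have h1 : Nat.blt j i = true := by simpa [Nat.blt_eq] using h
    have h2 : Nat.blt i j = false := by
      rw [Bool.eq_false_iff]; simp [Nat.blt_eq]; omega
    rw [h1, h2]; simp

lemma pathArc_pathCode : ∀ b02 b03 b13 b04 b14 b24 : Bool,
    let a := pathArc (pathCode b02 b03 b13 b04 b14 b24)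
    (a 0 1 = true ∧ a 1 2 = true ∧ a 2 3 = true ∧ a 3 4 = true) ∧
      a 0 2 = b02 ∧ a 0 3 = b03 ∧ a 1 3 = b13 ∧ a 0 4 = b04 ∧ a 1 4 = b14 ∧ a 2 4 = b24 := by
  decide

/-- The certificate, for the tournaments with a given Hamiltonian path: the defects of the `120`
relabellings of a tournament on five vertices cancel. -/
lemma sum_listDefect : ∀ b02 b03 b13 b04 b14 b24 : Bool,
    (arrangements.map (listDefect (pathArc (pathCode b02 b03 b13 b04 b14 b24)))).sum = 0 := by
  decide +kernel

/-- The explicit list enumerates the permutations, so the finite computation speaks about sums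
over the symmetric group. -/
lemma map_perm_eq_arrangements :
    (Finset.univ : Finset (Equiv.Perm (Fin 5))).val.map (fun π => List.ofFn fun i => (π i : ℕ)) =
      (arrangements : Multiset (List ℕ)) := by
  decide +kernel

/-- The defect of a tuple of five vertices in a tournament with arcs `b`. -/
def tupleDefect {V : Type*} (b : V → V → Bool) (x : Fin 5 → V) : ℤ :=
  defect (b (x 0) (x 1)) (b (x 0) (x 2)) (b (x 1) (x 2)) (b (x 0) (x 3)) (b (x 1) (x 3))
    (b (x 2) (x 3)) (b (x 0) (x 4)) (b (x 1) (x 4)) (b (x 2) (x 4)) (b (x 3) (x 4))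

lemma tupleDefect_congr {V W : Type*} {b : V → V → Bool} {b' : W → W → Bool} {x : Fin 5 → V}
    {x' : Fin 5 → W} (h : ∀ i j, i ≠ j → b (x i) (x j) = b' (x' i) (x' j)) :
    tupleDefect b x = tupleDefect b' x' := by
  unfold tupleDefect
  rw [h 0 1 (by decide), h 0 2 (by decide), h 1 2 (by decide), h 0 3 (by decide),
    h 1 3 (by decide), h 2 3 (by decide), h 0 4 (by decide), h 1 4 (by decide),
    h 2 4 (by decide), h 3 4 (by decide)]

lemma sum_perm_tupleDefect_of_path {b : Fin 5 → Fin 5 → Bool}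
    (hb : ∀ i j, i ≠ j → b j i = !b i j) (h01 : b 0 1 = true) (h12 : b 1 2 = true)
    (h23 : b 2 3 = true) (h34 : b 3 4 = true) :
    ∑ π : Equiv.Perm (Fin 5), tupleDefect b π = 0 := by
  obtain ⟨⟨g01, g12, g23, g34⟩, g02, g03, g13, g04, g14, g24⟩ :=
    pathArc_pathCode (b 0 2) (b 0 3) (b 1 3) (b 0 4) (b 1 4) (b 2 4)
  have hs := sum_listDefect (b 0 2) (b 0 3) (b 1 3) (b 0 4) (b 1 4) (b 2 4)
  set m := pathCode (b 0 2) (b 0 3) (b 1 3) (b 0 4) (b 1 4) (b 2 4)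
  have hlt : ∀ i j : Fin 5, i < j → b i j = pathArc m i j := by
    intro i j hij
    fin_cases i <;> fin_cases j <;> first | (exact absurd hij (by decide)) | skip
    · exact h01.trans g01.symm
    · exact g02.symm
    · exact g03.symm
    · exact g04.symm
    · exact h12.trans g12.symm
    · exact g13.symm
    · exact g14.symm
    · exact h23.trans g23.symm
    · exact g24.symm
    · exact h34.trans g34.symm
  have hne : ∀ i j : Fin 5, i ≠ j → b i j = pathArc m i j := by
    intro i j hij
    rcases lt_or_gt_of_ne hij with h | h
    · exact hlt i j h
    · rw [hb j i h.ne, pathArc_symm m (fun e => h.ne (Fin.ext e)), hlt j i h]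
  have hterm : ∀ π : Equiv.Perm (Fin 5), tupleDefect b π =
      listDefect (pathArc m) (List.ofFn fun i => (π i : ℕ)) := by
    intro π
    have : listDefect (pathArc m) (List.ofFn fun i => (π i : ℕ)) =
        tupleDefect (pathArc m) (fun i => (π i : ℕ)) := by
      simp [listDefect, tupleDefect, List.ofFn_succ]
    rw [this]
    exact tupleDefect_congr fun i j hij => hne _ _ (π.injective.ne hij)
  calc ∑ π : Equiv.Perm (Fin 5), tupleDefect b π
      = (((Finset.univ : Finset (Equiv.Perm (Fin 5))).val.map
          (fun π => List.ofFn fun i => (π i : ℕ))).map (listDefect (pathArc m))).sum := by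
        rw [Multiset.map_map]
        exact Finset.sum_congr rfl fun π _ => hterm π
    _ = 0 := by
        rw [map_perm_eq_arrangements, Multiset.map_coe, Multiset.sum_coe, hs]

/-! ### Hamiltonian paths -/

section Path
variable {V : Type*} (T : Tournament V)

/-- Inserting a vertex into a path: it fits before the first vertex that it dominates. -/
lemma exists_path_cons (a : V) : ∀ l : List V, l.IsChain T.Adj → a ∉ l →
    ∃ l' : List V, l'.Perm (a :: l) ∧ l'.IsChain T.Adj ∧
      ∀ c ∈ l'.head?, c = a ∨ c ∈ l.head?
  | [], _, _ => ⟨[a], List.Perm.refl _, by simp, by simp⟩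
  | b :: l, hl, ha => by
    have hab : a ≠ b := fun e => ha (by simp [e])
    by_cases h : T.Adj a b
    · exact ⟨a :: b :: l, List.Perm.refl _, by simpa [List.isChain_cons_cons] using ⟨h, hl⟩,
        by simp⟩
    · obtain ⟨l', hp, hc, hh⟩ := exists_path_cons a l
        (List.IsChain.tail hl) (fun e => ha (by simp [e]))
      refine ⟨b :: l', (hp.cons b).trans (List.Perm.swap _ _ _), ?_, by simp⟩
      rw [List.isChain_cons]
      refine ⟨fun c hc' => ?_, hc⟩
      rcases hh c hc' with rfl | h2
      · exact adj_of_not_adj hab h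
      · exact (List.isChain_cons.1 hl).1 c h2

/-- Every finite set of vertices of a tournament is spanned by a path. -/
lemma exists_path (l : List V) (hl : l.Nodup) :
    ∃ l' : List V, l'.Perm l ∧ l'.IsChain T.Adj := by
  induction l with
  | nil => exact ⟨[], List.Perm.refl _, by simp⟩
  | cons a l ih =>
    obtain ⟨l', hp, hc⟩ := ih (List.nodup_cons.1 hl).2
    obtain ⟨l'', hp', hc', -⟩ := T.exists_path_cons a l' hc
      (fun e => (List.nodup_cons.1 hl).1 (hp.mem_iff.1 e))
    exact ⟨l'', hp'.trans (hp.cons a), hc'⟩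

lemma exists_perm_path (T : Tournament (Fin 5)) : ∃ σ : Equiv.Perm (Fin 5),
    T.Adj (σ 0) (σ 1) ∧ T.Adj (σ 1) (σ 2) ∧ T.Adj (σ 2) (σ 3) ∧ T.Adj (σ 3) (σ 4) := by
  obtain ⟨l, hp, hc⟩ := T.exists_path (List.finRange 5) (List.nodup_finRange 5)
  have hlen : l.length = 5 := by simpa using hp.length_eq
  have hnd : l.Nodup := hp.nodup_iff.2 (List.nodup_finRange 5)
  match l, hlen, hnd, hc with
  | [a, b, c, d, e], _, hnd, hc =>
    refine ⟨Equiv.ofBijective ([a, b, c, d, e].get) (Finite.injective_iff_bijective.1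
      (List.nodup_iff_injective_get.1 hnd)), ?_⟩
    simp only [List.isChain_cons_cons] at hc
    exact ⟨hc.1, hc.2.1, hc.2.2.1, hc.2.2.2.1⟩

end Path

/-! ### Cancellation of the defect -/

section Tuples
variable {V : Type*} (T : Tournament V)

open Classical in
/-- The defects of the relabellings of any five distinct vertices cancel: the sum is invariant under
relabelling, so a Hamiltonian path may be assumed to be `0 → 1 → 2 → 3 → 4`. -/
lemma sum_perm_tupleDefect {x : Fin 5 → V} (hx : Function.Injective x) :
    ∑ π : Equiv.Perm (Fin 5), tupleDefect (fun u v => decide (T.Adj u v)) (x ∘ π) = 0 := by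
  let H : Tournament (Fin 5) :=
    { Adj := fun i j => T.Adj (x i) (x j)
      loopless := fun i => T.loopless _
      exactly_one := fun i j h => T.exactly_one _ _ (hx.ne h) }
  obtain ⟨σ, h01, h12, h23, h34⟩ := exists_perm_path H
  rw [← Equiv.sum_comp (Equiv.mulLeft σ)]
  have := sum_perm_tupleDefect_of_path (b := fun i j => decide (H.Adj (σ i) (σ j))) (by
    intro i j hij
    have := H.exactly_one (σ i) (σ j) (σ.injective.ne hij)
    by_cases h : H.Adj (σ j) (σ i) <;> simp [h, this]) (by simpa using h01) (by simpa using h12)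
      (by simpa using h23) (by simpa using h34)
  rw [← this]
  rfl

open Classical in
/-- The defect sums to zero over all tuples of five distinct vertices. -/
lemma sum_injective_tupleDefect [Fintype V] :
    ∑ x : Fin 5 → V with Function.Injective x,
      tupleDefect (fun u v => decide (T.Adj u v)) x = 0 := by
  have h : ∀ π : Equiv.Perm (Fin 5), ∑ x : Fin 5 → V with Function.Injective x,
      tupleDefect (fun u v => decide (T.Adj u v)) (x ∘ π) =
      ∑ x : Fin 5 → V with Function.Injective x,
        tupleDefect (fun u v => decide (T.Adj u v)) x := by
    intro π
    rw [Finset.sum_filter, Finset.sum_filter]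
    rw [← Equiv.sum_comp (Equiv.arrowCongr π.symm (Equiv.refl V))
      (fun x => if Function.Injective x then
        tupleDefect (fun u v => decide (T.Adj u v)) x else 0)]
    refine Finset.sum_congr rfl fun x _ => ?_
    have : (Equiv.arrowCongr π.symm (Equiv.refl V)) x = x ∘ π := by
      ext i; simp [Equiv.arrowCongr]
    simp only [this, Function.Injective.of_comp_iff' x π.bijective]
  have h2 : ∑ π : Equiv.Perm (Fin 5), ∑ x : Fin 5 → V with Function.Injective x,
      tupleDefect (fun u v => decide (T.Adj u v)) (x ∘ π) = 0 := by
    rw [Finset.sum_comm]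
    exact Finset.sum_eq_zero fun x hx => T.sum_perm_tupleDefect (Finset.mem_filter.1 hx).2
  rw [Finset.sum_congr rfl fun π _ => h π, Finset.sum_const, Finset.card_univ,
    Fintype.card_perm, Fintype.card_fin] at h2
  simpa [Nat.factorial] using h2

end Tuples


/-! ### Sums over tuples -/

section Tuples
variable {V : Type*} [Fintype V]

lemma sum_fin_succ_fun {n : ℕ} (g : (Fin (n + 1) → V) → ℝ) :
    ∑ x, g x = ∑ a, ∑ y : Fin n → V, g (Fin.cons a y) := by
  rw [← Equiv.sum_comp (Fin.consEquiv fun _ => V), Fintype.sum_prod_type]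
  rfl

lemma sum_fin_five_fun (g : V → V → V → V → V → ℝ) :
    ∑ x : Fin 5 → V, g (x 0) (x 1) (x 2) (x 3) (x 4) =
      ∑ x, ∑ y, ∑ z, ∑ u, ∑ v, g x y z u v := by
  simp only [sum_fin_succ_fun, Fintype.sum_unique]
  rfl

open Classical in
lemma card_injective_fun (k : ℕ) :
    (Finset.univ.filter fun x : Fin k → V => Function.Injective x).card =
      (Fintype.card V).descFactorial k := by
  rw [← Fintype.card_subtype, Fintype.card_congr (Equiv.subtypeInjectiveEquivEmbedding _ _),
    Fintype.card_embedding_eq, Fintype.card_fin]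

lemma descFactorial_ge (n k : ℕ) :
    (n : ℝ) ^ k - k ^ 2 * (n : ℝ) ^ (k - 1) ≤ n.descFactorial k := by
  rcases Nat.eq_zero_or_pos k with rfl | hk
  · simp
  induction k, hk using Nat.le_induction with
  | base => simp
  | succ k hk ih =>
    have h1 : (n : ℝ) - k ≤ ((n - k : ℕ) : ℝ) := by
      rcases le_total k n with h | h
      · rw [Nat.cast_sub h]
      · rw [Nat.sub_eq_zero_of_le h]
        have : (n : ℝ) ≤ k := by exact_mod_cast h
        simpa using this
    rw [Nat.descFactorial_succ]
    push_cast
    have hle : (n.descFactorial k : ℝ) ≤ (n : ℝ) ^ k := by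
      exact_mod_cast Nat.descFactorial_le_pow n k
    have hpos : (0 : ℝ) ≤ n.descFactorial k := by positivity
    have hn : (0 : ℝ) ≤ n := by positivity
    obtain ⟨j, rfl⟩ : ∃ j, k = j + 1 := ⟨k - 1, by omega⟩
    simp only [Nat.add_sub_cancel] at ih ⊢
    calc (n : ℝ) ^ (j + 1 + 1) - (((j + 1 : ℕ) : ℝ) + 1) ^ 2 * (n : ℝ) ^ (j + 1)
        ≤ n * ((n : ℝ) ^ (j + 1) - ((j + 1 : ℕ) : ℝ) ^ 2 * (n : ℝ) ^ j)
            - ((j + 1 : ℕ) : ℝ) * (n : ℝ) ^ (j + 1) := by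
          have : (0 : ℝ) ≤ (n : ℝ) ^ (j + 1) := by positivity
          have h3 : (n : ℝ) * (n : ℝ) ^ j = (n : ℝ) ^ (j + 1) := by ring
          have h4 : (n : ℝ) * (n : ℝ) ^ (j + 1) = (n : ℝ) ^ (j + 1 + 1) := by ring
          have h5 : (0 : ℝ) ≤ ((j + 1 : ℕ) : ℝ) := by positivity
          nlinarith [mul_nonneg h5 this]
      _ ≤ n * (n.descFactorial (j + 1) : ℝ) - ((j + 1 : ℕ) : ℝ) * n.descFactorial (j + 1) := by
          have h5 : (0 : ℝ) ≤ ((j + 1 : ℕ) : ℝ) := by positivity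
          have := mul_le_mul_of_nonneg_left ih hn
          have := mul_le_mul_of_nonneg_left hle h5
          linarith
      _ = (n - ((j + 1 : ℕ) : ℝ)) * n.descFactorial (j + 1) := by ring
      _ ≤ _ := mul_le_mul_of_nonneg_right h1 hpos

open Classical in
/-- Restricting a bounded sum over `k`-tuples to the injective ones changes it by
`O(n ^ (k - 1))`. -/
lemma abs_sum_sub_sum_injective_le {k : ℕ} (g : (Fin k → V) → ℝ) {M : ℝ}
    (hg : ∀ x, |g x| ≤ M) (hM : 0 ≤ M) :
    |∑ x, g x - ∑ x with Function.Injective x, g x| ≤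
      M * (k ^ 2 * (Fintype.card V : ℝ) ^ (k - 1)) := by
  rw [← Finset.sum_filter_add_sum_filter_not Finset.univ
    (fun x : Fin k → V => Function.Injective x), add_sub_cancel_left]
  refine (Finset.abs_sum_le_sum_abs _ _).trans ?_
  refine (Finset.sum_le_card_nsmul _ _ M fun x _ => hg x).trans ?_
  rw [nsmul_eq_mul, mul_comm]
  refine mul_le_mul_of_nonneg_left ?_ hM
  have h1 := Finset.card_filter_add_card_filter_not (s := Finset.univ)
    (fun x : Fin k → V => Function.Injective x)
  rw [card_injective_fun, Finset.card_univ, Fintype.card_fun, Fintype.card_fin] at h1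
  have h2 : ((Fintype.card V).descFactorial k : ℝ) +
    ((Finset.univ.filter fun x : Fin k → V => ¬ Function.Injective x).card : ℝ) =
      (Fintype.card V : ℝ) ^ k := by exact_mod_cast h1
  have := descFactorial_ge (Fintype.card V) k
  linarith

end Tuples

/-! ### The certificate as a sum of squares -/

section Certificate
variable {V : Type*} (T : Tournament V)

/-- The linear form of the certificate at a vertex `u`, relative to a transitive triple. -/
noncomputable def transSum (x y z u : V) : ℝ :=
  3 * T.sgn x u + 3 * T.sgn z u - T.sgn x u * T.sgn y u + T.sgn y u * T.sgn z u
    - 5 * (T.sgn x u * T.sgn y u * T.sgn z u)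

/-- The odd linear form of the certificate at a vertex `u`, relative to a cyclic triple. -/
noncomputable def oddSum (x y z u : V) : ℝ :=
  T.sgn x u + T.sgn y u + T.sgn z u + 5 * (T.sgn x u * T.sgn y u * T.sgn z u)

/-- The even linear form of the certificate at a vertex `u`, relative to a cyclic triple. -/
noncomputable def evenSum (x y z u : V) : ℝ :=
  T.sgn x u * T.sgn y u + T.sgn y u * T.sgn z u + T.sgn z u * T.sgn x u

open Classical in
/-- The indicator of a transitive triple, listed from source to sink. -/
noncomputable def transInd (x y z : V) : ℝ := if T.Adj x y ∧ T.Adj y z ∧ T.Adj x z then 1 else 0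

open Classical in
/-- The indicator of a cyclic triple, listed along the cycle. -/
noncomputable def cycInd (x y z : V) : ℝ := if T.Adj x y ∧ T.Adj y z ∧ T.Adj z x then 1 else 0

/-- The part of the certificate that becomes a sum of squares once summed over all `5`-tuples
`(x, y, z, u, v)`. For most terms the squares arise from the sum over `u, v` for fixed `x, y, z`;
the term with coefficient `93` gives `(∑ u, sgn x u) ^ 4`, and the last term with coefficient `24`
gives `(∑ x, codeg x y) ^ 2`, after summation over the remaining roots. -/
noncomputable def cert (x y z u v : V) : ℝ :=
  24 * (T.transInd x y z * (T.transSum x y z u * T.transSum x y z v)) +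
  T.cycInd x y z * (32 * (T.oddSum x y z u * T.oddSum x y z v) +
    32 * (T.evenSum x y z u * T.evenSum x y z v) +
    240 * ((T.sgn x u * T.sgn y u) * (T.sgn x v * T.sgn y v)) +
    240 * ((T.sgn y u * T.sgn z u) * (T.sgn y v * T.sgn z v)) +
    240 * ((T.sgn z u * T.sgn x u) * (T.sgn z v * T.sgn x v))) +
  24 * (T.sgn x u * T.sgn x v) +
  93 * ((T.sgn x y * T.sgn x z) * (T.sgn x u * T.sgn x v)) +
  27 * ((T.sgn x u * T.sgn y u) * (T.sgn x v * T.sgn y v)) +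
  24 * ((T.sgn x u * T.sgn y u) * (T.sgn y v * T.sgn z v)) +
  11 * ((T.sgn x u * T.sgn y u * T.sgn z u) * (T.sgn x v * T.sgn y v * T.sgn z v))

variable {T}

open Classical in
lemma sgn_eq_boolSign {x y : V} (h : x ≠ y) : T.sgn x y = (boolSign (decide (T.Adj x y)) : ℝ) := by
  rw [sgn_eq_ite h]
  by_cases h' : T.Adj x y <;> simp [h', boolSign]

open Classical in
/-- Whether a tuple of distinct vertices is a labelled copy of `T₅⁸`. -/
noncomputable def isCopy (T : Tournament V) (x y z u v : V) : Bool :=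
  decide (T.Adj x y) && decide (T.Adj y z) && decide (T.Adj z u) && decide (T.Adj u v) &&
    !decide (T.Adj x v) && decide (T.Adj x z) && decide (T.Adj x u) && decide (T.Adj y u) &&
    decide (T.Adj y v) && !decide (T.Adj z v)

open Classical in
lemma tupleDefect_cast {x : Fin 5 → V} (hx : Function.Injective x) :
    ((tupleDefect (fun u v => decide (T.Adj u v)) x : ℤ) : ℝ) =
      45 - cond (T.isCopy (x 0) (x 1) (x 2) (x 3) (x 4)) 46080 0 -
        T.cert (x 0) (x 1) (x 2) (x 3) (x 4) := by
  have hne : ∀ i j : Fin 5, i ≠ j → x i ≠ x j := fun i j h => hx.ne h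
  have hT : T.transInd (x 0) (x 1) (x 2) = ((cond (decide (T.Adj (x 0) (x 1)) &&
      decide (T.Adj (x 1) (x 2)) && decide (T.Adj (x 0) (x 2))) 1 0 : ℤ) : ℝ) := by
    unfold transInd
    by_cases h1 : T.Adj (x 0) (x 1) <;> by_cases h2 : T.Adj (x 1) (x 2) <;>
      by_cases h3 : T.Adj (x 0) (x 2) <;> simp [h1, h2, h3]
  have hC : T.cycInd (x 0) (x 1) (x 2) = ((cond (decide (T.Adj (x 0) (x 1)) &&
      decide (T.Adj (x 1) (x 2)) && !decide (T.Adj (x 0) (x 2))) 1 0 : ℤ) : ℝ) := by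
    have h4 := T.exactly_one (x 2) (x 0) (hne 2 0 (by decide))
    unfold cycInd
    rw [h4]
    by_cases h1 : T.Adj (x 0) (x 1) <;> by_cases h2 : T.Adj (x 1) (x 2) <;>
      by_cases h3 : T.Adj (x 0) (x 2) <;> simp [h1, h2, h3]
  have hcond : ∀ (b : Bool) (t : ℤ), cond b t 0 = cond b 1 0 * t := by
    intro b t; cases b <;> simp
  have hcopy : ((cond (T.isCopy (x 0) (x 1) (x 2) (x 3) (x 4)) 46080 0 : ℤ) : ℝ) =
      cond (T.isCopy (x 0) (x 1) (x 2) (x 3) (x 4)) 46080 0 := by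
    cases T.isCopy (x 0) (x 1) (x 2) (x 3) (x 4) <;> simp
  unfold tupleDefect defect cert
  rw [hcond _ (24 * _), hcond _ (cycForm _ _ _ _ _ _), hT, hC, ← hcopy]
  unfold transSum oddSum evenSum transForm cycForm
  rw [sgn_eq_boolSign (hne 0 3 (by decide)),
    sgn_eq_boolSign (hne 1 3 (by decide)), sgn_eq_boolSign (hne 2 3 (by decide)),
    sgn_eq_boolSign (hne 0 4 (by decide)), sgn_eq_boolSign (hne 1 4 (by decide)),
    sgn_eq_boolSign (hne 2 4 (by decide)), sgn_eq_boolSign (hne 0 1 (by decide)),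
    sgn_eq_boolSign (hne 0 2 (by decide))]
  push_cast
  unfold isCopy
  ring

lemma abs_mul_le_one {a b : ℝ} (ha : |a| ≤ 1) (hb : |b| ≤ 1) : |a * b| ≤ 1 := by
  rw [abs_mul]; exact mul_le_one₀ ha (abs_nonneg _) hb

lemma abs_transSum_le (x y z u : V) : |T.transSum x y z u| ≤ 13 := by
  have hx := T.abs_sgn_le x u
  have hy := T.abs_sgn_le y u
  have hz := T.abs_sgn_le z u
  have h1 := abs_mul_le_one hx hy
  have h2 := abs_mul_le_one hy hz
  have h3 := abs_mul_le_one h1 hz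
  rw [abs_le] at *
  unfold transSum
  constructor <;> linarith [hx.1, hx.2, hz.1, hz.2, h1.1, h1.2, h2.1, h2.2, h3.1, h3.2]

lemma abs_oddSum_le (x y z u : V) : |T.oddSum x y z u| ≤ 8 := by
  have hx := T.abs_sgn_le x u
  have hy := T.abs_sgn_le y u
  have hz := T.abs_sgn_le z u
  have h3 := abs_mul_le_one (abs_mul_le_one hx hy) hz
  rw [abs_le] at *
  unfold oddSum
  constructor <;> linarith [hx.1, hx.2, hy.1, hy.2, hz.1, hz.2, h3.1, h3.2]

lemma abs_evenSum_le (x y z u : V) : |T.evenSum x y z u| ≤ 3 := by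
  have h1 := abs_mul_le_one (T.abs_sgn_le x u) (T.abs_sgn_le y u)
  have h2 := abs_mul_le_one (T.abs_sgn_le y u) (T.abs_sgn_le z u)
  have h3 := abs_mul_le_one (T.abs_sgn_le z u) (T.abs_sgn_le x u)
  rw [abs_le] at *
  unfold evenSum
  constructor <;> linarith [h1.1, h1.2, h2.1, h2.2, h3.1, h3.2]

lemma abs_cert_le (x y z u v : V) : |T.cert x y z u v| ≤ 10000 := by
  have hs := T.abs_sgn_le
  have mul_bound : ∀ {a b c d : ℝ}, |a| ≤ c → |b| ≤ d → |a * b| ≤ c * d := by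
    intro a b c d ha hb
    rw [abs_mul]
    exact mul_le_mul ha hb (abs_nonneg _) ((abs_nonneg _).trans ha)
  have p : ∀ a b c : V, |T.sgn a c * T.sgn b c| ≤ 1 :=
    fun a b c => abs_mul_le_one (hs _ _) (hs _ _)
  have hT : |T.transInd x y z| ≤ 1 := by unfold transInd; split_ifs <;> simp
  have hC : |T.cycInd x y z| ≤ 1 := by unfold cycInd; split_ifs <;> simp
  have t1 := mul_bound hT
    (mul_bound (abs_transSum_le (T := T) x y z u) (abs_transSum_le (T := T) x y z v))
  have t2 := mul_bound (abs_oddSum_le (T := T) x y z u) (abs_oddSum_le (T := T) x y z v)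
  have t3 := mul_bound (abs_evenSum_le (T := T) x y z u) (abs_evenSum_le (T := T) x y z v)
  have t4 := abs_mul_le_one (p x y u) (p x y v)
  have t5 := abs_mul_le_one (p y z u) (p y z v)
  have t6 := abs_mul_le_one (p z x u) (p z x v)
  have t7 : |32 * (T.oddSum x y z u * T.oddSum x y z v) +
    32 * (T.evenSum x y z u * T.evenSum x y z v) +
    240 * ((T.sgn x u * T.sgn y u) * (T.sgn x v * T.sgn y v)) +
    240 * ((T.sgn y u * T.sgn z u) * (T.sgn y v * T.sgn z v)) +
    240 * ((T.sgn z u * T.sgn x u) * (T.sgn z v * T.sgn x v))| ≤ 3100 := by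
    rw [abs_le] at *
    constructor <;> linarith [t2.1, t2.2, t3.1, t3.2, t4.1, t4.2, t5.1, t5.2, t6.1, t6.2]
  have t8 := mul_bound hC t7
  have t9 := abs_mul_le_one (hs x u) (hs x v)
  have t10 := abs_mul_le_one (abs_mul_le_one (hs x y) (hs x z)) t9
  have t11 := abs_mul_le_one (p x y u) (p y z v)
  have t12 := abs_mul_le_one (abs_mul_le_one (p x y u) (hs z u)) (abs_mul_le_one (p x y v) (hs z v))
  unfold cert
  rw [abs_le] at *
  constructor <;> linarith [t1.1, t1.2, t8.1, t8.2, t9.1, t9.2, t10.1, t10.2, t11.1, t11.2, t12.1,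
    t12.2, t4.1, t4.2]

end Certificate

/-! ### The number of labelled copies of `T₅⁸` -/

section Bound
variable {V : Type*} [Fintype V] (T : Tournament V)

/-- The signed codegree of two vertices. -/
noncomputable def codeg (x y : V) : ℝ := ∑ u, T.sgn x u * T.sgn y u

/-- The signed count of closed walks of length four. Its order of magnitude is at most `n ^ 4`, and
it is `o(n ^ 4)` exactly along quasi-random sequences. -/
noncomputable def energy : ℝ := ∑ x, ∑ y, T.codeg x y ^ 2

lemma energy_nonneg : 0 ≤ T.energy :=
  Finset.sum_nonneg fun _ _ => Finset.sum_nonneg fun _ _ => sq_nonneg _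

lemma codeg_symm (x y : V) : T.codeg x y = T.codeg y x :=
  Finset.sum_congr rfl fun _ _ => mul_comm _ _

lemma sum_sum_mul (a b : V → ℝ) (c : ℝ) :
    ∑ u, ∑ v, c * (a u * b v) = c * ((∑ u, a u) * ∑ v, b v) := by
  rw [Finset.sum_mul_sum, Finset.mul_sum]
  exact Finset.sum_congr rfl fun _ _ => (Finset.mul_sum _ _ _).symm

/-- For fixed `x, y, z`, all terms of the certificate but one are nonnegative multiples of squares,
or will be after summation over `x, y, z`. -/
lemma le_sum_cert (x y z : V) :
    93 * ((T.sgn x y * T.sgn x z) * (∑ u, T.sgn x u) ^ 2) + 27 * T.codeg x y ^ 2 +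
      24 * (T.codeg x y * T.codeg y z) ≤ ∑ u, ∑ v, T.cert x y z u v := by
  have hT : 0 ≤ T.transInd x y z := by unfold transInd; split_ifs <;> simp
  have hC : 0 ≤ T.cycInd x y z := by unfold cycInd; split_ifs <;> simp
  have key : ∑ u, ∑ v, T.cert x y z u v =
      24 * (T.transInd x y z * (∑ u, T.transSum x y z u) ^ 2) +
      T.cycInd x y z * (32 * (∑ u, T.oddSum x y z u) ^ 2 + 32 * (∑ u, T.evenSum x y z u) ^ 2 +
        240 * T.codeg x y ^ 2 + 240 * T.codeg y z ^ 2 + 240 * T.codeg z x ^ 2) +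
      24 * (∑ u, T.sgn x u) ^ 2 + 93 * ((T.sgn x y * T.sgn x z) * (∑ u, T.sgn x u) ^ 2) +
      27 * T.codeg x y ^ 2 + 24 * (T.codeg x y * T.codeg y z) +
      11 * (∑ u, T.sgn x u * T.sgn y u * T.sgn z u) ^ 2 := by
    unfold cert
    simp only [Finset.sum_add_distrib, mul_add, ← mul_assoc (T.cycInd x y z),
      ← mul_assoc (24 : ℝ) (T.transInd x y z),
      ← mul_assoc (93 : ℝ) (T.sgn x y * T.sgn x z), sum_sum_mul]
    simp only [codeg]
    ring
  rw [key]
  have : 0 ≤ T.transInd x y z * (∑ u, T.transSum x y z u) ^ 2 := by positivity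
  have : 0 ≤ T.cycInd x y z * (32 * (∑ u, T.oddSum x y z u) ^ 2 +
      32 * (∑ u, T.evenSum x y z u) ^ 2 +
        240 * T.codeg x y ^ 2 + 240 * T.codeg y z ^ 2 + 240 * T.codeg z x ^ 2) := by positivity
  nlinarith [sq_nonneg (∑ u, T.sgn x u), sq_nonneg (∑ u, T.sgn x u * T.sgn y u * T.sgn z u)]

lemma energy_le_sum_cert :
    27 * (Fintype.card V * T.energy) ≤ ∑ x, ∑ y, ∑ z, ∑ u, ∑ v, T.cert x y z u v := by
  refine le_trans ?_ (Finset.sum_le_sum fun x _ => Finset.sum_le_sum fun y _ =>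
    Finset.sum_le_sum fun z _ => T.le_sum_cert x y z)
  simp only [Finset.sum_add_distrib]
  have h1 : 0 ≤ ∑ x, ∑ y, ∑ z, 93 * ((T.sgn x y * T.sgn x z) * (∑ u, T.sgn x u) ^ 2) := by
    refine Finset.sum_nonneg fun x _ => ?_
    have : ∑ y, ∑ z, 93 * ((T.sgn x y * T.sgn x z) * (∑ u, T.sgn x u) ^ 2) =
        93 * ((∑ u, T.sgn x u) ^ 2) ^ 2 := by
      calc _ = ∑ y, ∑ z, (93 * (∑ u, T.sgn x u) ^ 2) * (T.sgn x y * T.sgn x z) :=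
            Finset.sum_congr rfl fun _ _ => Finset.sum_congr rfl fun _ _ => by ring
        _ = _ := by rw [sum_sum_mul]; ring
    rw [this]; positivity
  have h2 : ∑ x, ∑ y, ∑ _z : V, 27 * T.codeg x y ^ 2 = 27 * (Fintype.card V * T.energy) := by
    simp only [Finset.sum_const, Finset.card_univ, nsmul_eq_mul, energy, Finset.mul_sum]
    exact Finset.sum_congr rfl fun _ _ => Finset.sum_congr rfl fun _ _ => by ring
  have h3 : 0 ≤ ∑ x, ∑ y, ∑ z, 24 * (T.codeg x y * T.codeg y z) := by
    rw [Finset.sum_comm]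
    refine Finset.sum_nonneg fun y _ => ?_
    rw [sum_sum_mul (fun x => T.codeg x y) (T.codeg y) 24]
    simp only [T.codeg_symm _ y]
    nlinarith [mul_self_nonneg (∑ x, T.codeg y x)]
  linarith

instance : DecidableRel T58.Adj := fun i j => by
  unfold T58; infer_instance

open Classical in
lemma card_embedding_le_card_isCopy : Nat.card (T58.Adj ↪r T.Adj) ≤
    (Finset.univ.filter fun x : Fin 5 → V => Function.Injective x ∧
      T.isCopy (x 0) (x 1) (x 2) (x 3) (x 4) = true).card := by
  rw [← Fintype.card_subtype, ← Nat.card_eq_fintype_card]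
  refine Nat.card_le_card_of_injective (fun e => ⟨e, e.injective, ?_⟩) ?_
  · have h : ∀ i j, T58.Adj i j → T.Adj (e i) (e j) := fun i j h => e.map_rel_iff.2 h
    have h' : ∀ i j, T58.Adj j i → ¬ T.Adj (e i) (e j) := fun i j hh => adj_asymm (h j i hh)
    simp [isCopy, h 0 1 (by decide), h 1 2 (by decide), h 2 3 (by decide), h 3 4 (by decide),
      h' 0 4 (by decide), h 0 2 (by decide), h 0 3 (by decide), h 1 3 (by decide),
      h 1 4 (by decide), h' 2 4 (by decide)]
  · intro e e' h
    ext i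
    exact congrFun (congrArg Subtype.val h) i

/-- The certificate bounds the number of labelled copies of `T₅⁸`. -/
lemma card_embedding_T58_le :
    46080 * (Nat.card (T58.Adj ↪r T.Adj) : ℝ) ≤ 45 * (Fintype.card V).descFactorial 5 -
      27 * (Fintype.card V * T.energy) + 250000 * (Fintype.card V : ℝ) ^ 4 := by
  classical
  have h0 := congrArg (Int.cast : ℤ → ℝ) T.sum_injective_tupleDefect
  rw [Int.cast_sum, Finset.sum_congr rfl fun x hx => tupleDefect_cast (Finset.mem_filter.1 hx).2,
    Finset.sum_sub_distrib, Finset.sum_sub_distrib, Finset.sum_const, card_injective_fun,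
    nsmul_eq_mul, Int.cast_zero] at h0
  have h1 : ∑ x : Fin 5 → V with Function.Injective x,
      (cond (T.isCopy (x 0) (x 1) (x 2) (x 3) (x 4)) 46080 0 : ℝ) = 46080 *
      ((Finset.univ.filter fun x : Fin 5 → V => Function.Injective x ∧
      T.isCopy (x 0) (x 1) (x 2) (x 3) (x 4) = true).card : ℝ) := by
    rw [← Finset.filter_filter, Finset.card_filter, Nat.cast_sum, Finset.mul_sum]
    refine Finset.sum_congr rfl fun x _ => ?_
    cases T.isCopy (x 0) (x 1) (x 2) (x 3) (x 4) <;> simp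
  have h2 := abs_sum_sub_sum_injective_le
    (fun x : Fin 5 → V => T.cert (x 0) (x 1) (x 2) (x 3) (x 4)) (M := 10000)
    (fun x => abs_cert_le _ _ _ _ _) (by norm_num)
  rw [sum_fin_five_fun] at h2
  have h3 := T.energy_le_sum_cert
  have h4 : (Nat.card (T58.Adj ↪r T.Adj) : ℝ) ≤ _ :=
    Nat.cast_le.2 T.card_embedding_le_card_isCopy
  have h5 := (abs_le.1 h2).2
  norm_num at h5
  linarith

end Bound

/-! ### The counting lemma -/

section Counting
variable {V : Type*} [Fintype V] (T : Tournament V)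

lemma sq_sum_mul_le {ι : Type*} [Fintype ι] (a r : ι → ℝ) (ha : ∀ i, |a i| ≤ 1) :
    (∑ i, a i * r i) ^ 2 ≤ Fintype.card ι * ∑ i, r i ^ 2 := by
  refine (Finset.sum_mul_sq_le_sq_mul_sq _ a r).trans ?_
  refine mul_le_mul_of_nonneg_right ?_ (Finset.sum_nonneg fun _ _ => sq_nonneg _)
  calc ∑ i, a i ^ 2 ≤ ∑ _i : ι, (1 : ℝ) :=
        Finset.sum_le_sum fun i _ => (sq_le_one_iff_abs_le_one _).2 (ha i)
    _ = Fintype.card ι := by simp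

/-- The energy bounds the cut norm, by two applications of the Cauchy–Schwarz inequality. -/
lemma bilinear_pow_four_le {a b : V → ℝ} (ha : ∀ x, |a x| ≤ 1) (hb : ∀ x, |b x| ≤ 1) :
    (∑ p, ∑ q, a p * b q * T.sgn p q) ^ 4 ≤ (Fintype.card V : ℝ) ^ 4 * T.energy := by
  have h1 : ∑ p, ∑ q, a p * b q * T.sgn p q = ∑ p, a p * ∑ q, b q * T.sgn p q := by
    simp only [Finset.mul_sum, mul_assoc]
  have h2 : ∑ p, (∑ q, b q * T.sgn p q) ^ 2 = ∑ z : V × V, (b z.1 * b z.2) * T.codeg z.1 z.2 := by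
    rw [Fintype.sum_prod_type]
    simp only [sq, Finset.sum_mul_sum]
    simp only [codeg, Finset.mul_sum]
    rw [Finset.sum_comm]
    refine Finset.sum_congr rfl fun q _ => ?_
    rw [Finset.sum_comm]
    refine Finset.sum_congr rfl fun q' _ => Finset.sum_congr rfl fun p _ => ?_
    rw [T.sgn_symm p q, T.sgn_symm p q']
    ring
  have h3 := sq_sum_mul_le a (fun p => ∑ q, b q * T.sgn p q) ha
  have h4 := sq_sum_mul_le (fun z : V × V => b z.1 * b z.2) (fun z => T.codeg z.1 z.2)
    (fun z => abs_mul_le_one (hb _) (hb _))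
  rw [← h2, Fintype.card_prod, Fintype.sum_prod_type] at h4
  rw [h1]
  push_cast at h4
  have h5 : (0 : ℝ) ≤ Fintype.card V * ∑ p, (∑ q, b q * T.sgn p q) ^ 2 :=
    mul_nonneg (by positivity) (Finset.sum_nonneg fun _ _ => sq_nonneg _)
  calc (∑ p, a p * ∑ q, b q * T.sgn p q) ^ 4
      = ((∑ p, a p * ∑ q, b q * T.sgn p q) ^ 2) ^ 2 := by ring
    _ ≤ (Fintype.card V * ∑ p, (∑ q, b q * T.sgn p q) ^ 2) ^ 2 :=
        pow_le_pow_left₀ (sq_nonneg _) h3 2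
    _ = (Fintype.card V : ℝ) ^ 2 * (∑ p, (∑ q, b q * T.sgn p q) ^ 2) ^ 2 := by ring
    _ ≤ (Fintype.card V : ℝ) ^ 2 * (Fintype.card V * Fintype.card V * T.energy) :=
        mul_le_mul_of_nonneg_left h4 (by positivity)
    _ = _ := by ring

lemma abs_bilinear_le {a b : V → ℝ} (ha : ∀ x, |a x| ≤ 1) (hb : ∀ x, |b x| ≤ 1) {δ : ℝ}
    (hδ : 0 ≤ δ) (h : T.energy ≤ δ ^ 4 * (Fintype.card V : ℝ) ^ 4) :
    |∑ p, ∑ q, a p * b q * T.sgn p q| ≤ δ * (Fintype.card V : ℝ) ^ 2 := by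
  rw [← pow_le_pow_iff_left₀ (abs_nonneg _) (by positivity) (four_ne_zero)]
  rw [show |∑ p, ∑ q, a p * b q * T.sgn p q| ^ 4 = (∑ p, ∑ q, a p * b q * T.sgn p q) ^ 4 from
    (by decide : Even 4).pow_abs _]
  refine (T.bilinear_pow_four_le ha hb).trans ?_
  calc (Fintype.card V : ℝ) ^ 4 * T.energy
      ≤ (Fintype.card V : ℝ) ^ 4 * (δ ^ 4 * (Fintype.card V : ℝ) ^ 4) :=
        mul_le_mul_of_nonneg_left h (by positivity)
    _ = _ := by ring

/-- Resampling one coordinate of a uniformly random tuple does not change its distribution. -/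
lemma sum_sum_update {k : ℕ} (i : Fin k) (g : (Fin k → V) → ℝ) :
    ∑ x, ∑ p, g (Function.update x i p) = Fintype.card V * ∑ x, g x := by
  have hinv : Function.Involutive
      (fun z : (Fin k → V) × V => (Function.update z.1 i z.2, z.1 i)) := by
    rintro ⟨x, p⟩
    simp
  have := Equiv.sum_comp hinv.toPerm (fun z : (Fin k → V) × V => g z.1)
  rw [Fintype.sum_prod_type, Fintype.sum_prod_type] at this
  simp only [Function.Involutive.coe_toPerm] at this
  rw [this]
  simp [Finset.mul_sum]

/-- The product of the signs of the arcs of a tuple along a set of index pairs. -/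
noncomputable def signProd {k : ℕ} (D : Finset (Fin k × Fin k)) (x : Fin k → V) : ℝ :=
  ∏ e ∈ D, T.sgn (x e.1) (x e.2)

omit [Fintype V] in
lemma abs_signProd_le {k : ℕ} (D : Finset (Fin k × Fin k)) (x : Fin k → V) :
    |T.signProd D x| ≤ 1 := by
  unfold signProd
  rw [Finset.abs_prod]
  exact Finset.prod_le_one (fun _ _ => abs_nonneg _) fun _ _ => T.abs_sgn_le _ _

/-- The pairs `i < j` of indices. -/
def pairs (k : ℕ) : Finset (Fin k × Fin k) := Finset.univ.filter fun e => e.1 < e.2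

lemma card_pairs (k : ℕ) : (pairs k).card = k.choose 2 := by
  have h : ∀ j : Fin k, ∑ i : Fin k, (if i < j then 1 else 0) = (j : ℕ) := fun j => by
    rw [← Finset.card_filter, Finset.filter_gt_eq_Iio, Fin.card_Iio]
  rw [pairs, Finset.card_filter, Fintype.sum_prod_type, Finset.sum_comm]
  simp only [h]
  rw [Fin.sum_univ_eq_sum_range (fun j => j), Finset.sum_range_id, Nat.choose_two_right]

omit [Fintype V] in
/-- As a function of the vertices at `i` and `j`, the product over `D ∋ (i, j)` is the sign of their
arc times a function of each. -/
lemma signProd_update {k : ℕ} {D : Finset (Fin k × Fin k)} (hD : D ⊆ pairs k) {i j : Fin k}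
    (hij : (i, j) ∈ D) (x : Fin k → V) (p q : V) :
    T.signProd D (Function.update (Function.update x i p) j q) =
      T.signProd ((D.erase (i, j)).filter fun e => e.1 ≠ j ∧ e.2 ≠ j) (Function.update x i p) *
      T.signProd ((D.erase (i, j)).filter fun e => ¬ (e.1 ≠ j ∧ e.2 ≠ j)) (Function.update x j q) *
      T.sgn p q := by
  have hlt : i < j := (Finset.mem_filter.1 (hD hij)).2
  unfold signProd
  rw [← Finset.mul_prod_erase D _ hij, ← Finset.prod_filter_mul_prod_filter_not (D.erase (i, j))
    (fun e => e.1 ≠ j ∧ e.2 ≠ j), mul_comm]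
  congr 1
  · congr 1
    · refine Finset.prod_congr rfl fun e he => ?_
      obtain ⟨-, h1, h2⟩ := Finset.mem_filter.1 he
      rw [Function.update_of_ne h1, Function.update_of_ne h2]
    · refine Finset.prod_congr rfl fun e he => ?_
      obtain ⟨he, h⟩ := Finset.mem_filter.1 he
      obtain ⟨hne, heD⟩ := Finset.mem_erase.1 he
      have hlt' : e.1 < e.2 := (Finset.mem_filter.1 (hD heD)).2
      have h1 : e.1 ≠ i := by
        intro h1
        have h2 : e.2 ≠ j := fun h2 => hne (Prod.ext h1 h2)
        exact h ⟨fun h3 => hlt.ne (h1.symm.trans h3), h2⟩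
      have h2 : e.2 ≠ i := by
        intro h2
        exact h ⟨fun h3 => by rw [h2, h3] at hlt'; exact hlt.asymm hlt', fun h3 =>
          hlt.ne (h2.symm.trans h3)⟩
      rw [Function.update_comm hlt.ne, Function.update_of_ne h1, Function.update_of_ne h2]
  · simp [Function.update_of_ne hlt.ne]

/-- Averages of nonempty products of signs are small when the energy is. -/
lemma abs_sum_signProd_le {k : ℕ} {D : Finset (Fin k × Fin k)} (hD : D ⊆ pairs k)
    (hne : D.Nonempty) {δ : ℝ} (hδ : 0 ≤ δ)
    (h : T.energy ≤ δ ^ 4 * (Fintype.card V : ℝ) ^ 4) :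
    |∑ x, T.signProd D x| ≤ δ * (Fintype.card V : ℝ) ^ k := by
  obtain ⟨⟨i, j⟩, hij⟩ := hne
  rcases isEmpty_or_nonempty V with hV | hV
  · have : IsEmpty (Fin k → V) := ⟨fun x => hV.elim (x i)⟩
    simp only [Finset.univ_eq_empty, Finset.sum_empty, abs_zero]
    positivity
  have hn : (0 : ℝ) < Fintype.card V := by exact_mod_cast Fintype.card_pos
  -- resample the ends of the arc `ij`; the other arcs see at most one of the two new vertices
  have h1 : (Fintype.card V : ℝ) ^ 2 * ∑ x, T.signProd D x =
      ∑ x, ∑ p, ∑ q, T.signProd D (Function.update (Function.update x i p) j q) := by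
    rw [sum_sum_update i (fun x => ∑ q, T.signProd D (Function.update x j q)),
      sum_sum_update j]
    ring
  have h2 : |(Fintype.card V : ℝ) ^ 2 * ∑ x, T.signProd D x| ≤
      (Fintype.card V : ℝ) ^ k * (δ * (Fintype.card V : ℝ) ^ 2) := by
    rw [h1]
    refine (Finset.abs_sum_le_sum_abs _ _).trans ?_
    refine (Finset.sum_le_card_nsmul _ _ (δ * (Fintype.card V : ℝ) ^ 2) fun x _ => ?_).trans ?_
    · simp only [T.signProd_update hD hij]
      exact T.abs_bilinear_le (fun p => T.abs_signProd_le _ _) (fun q => T.abs_signProd_le _ _) hδ h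
    · simp
  rw [abs_mul, abs_of_pos (by positivity : (0 : ℝ) < (Fintype.card V : ℝ) ^ 2)] at h2
  have h3 : (Fintype.card V : ℝ) ^ 2 * |∑ x, T.signProd D x| ≤
      (Fintype.card V : ℝ) ^ 2 * (δ * (Fintype.card V : ℝ) ^ k) := by linarith
  exact le_of_mul_le_mul_left h3 (by positivity)

/-- The indicator of a labelled copy of `F`, extended to all tuples. -/
noncomputable def copyWeight {k : ℕ} (F : Tournament (Fin k)) (x : Fin k → V) : ℝ :=
  ∏ e ∈ pairs k, (1 + F.sgn e.1 e.2 * T.sgn (x e.1) (x e.2)) / 2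

omit [Fintype V] in
lemma abs_copyWeight_le {k : ℕ} (F : Tournament (Fin k)) (x : Fin k → V) :
    |T.copyWeight F x| ≤ 1 := by
  unfold copyWeight
  rw [Finset.abs_prod]
  refine Finset.prod_le_one (fun _ _ => abs_nonneg _) fun e _ => ?_
  have := abs_le.1 (abs_mul_le_one (F.abs_sgn_le e.1 e.2) (T.abs_sgn_le (x e.1) (x e.2)))
  rw [abs_le]
  constructor <;> linarith

omit [Fintype V] in
open Classical in
lemma copyWeight_eq {k : ℕ} (F : Tournament (Fin k)) {x : Fin k → V}
    (hx : Function.Injective x) :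
    T.copyWeight F x = if ∀ i j, T.Adj (x i) (x j) ↔ F.Adj i j then 1 else 0 := by
  unfold copyWeight
  split_ifs with h
  · refine Finset.prod_eq_one fun e he => ?_
    have hne : e.1 ≠ e.2 := (Finset.mem_filter.1 he).2.ne
    rw [(sgn_eq_iff (hx.ne hne) hne).2 (h _ _), sgn_eq_ite hne]
    split_ifs <;> norm_num
  · push Not at h
    obtain ⟨i, j, h⟩ := h
    have key : ∀ i j : Fin k, i < j → ¬ (T.Adj (x i) (x j) ↔ F.Adj i j) →
        ∏ e ∈ pairs k, (1 + F.sgn e.1 e.2 * T.sgn (x e.1) (x e.2)) / 2 = 0 := by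
      intro i j hij h
      refine Finset.prod_eq_zero (i := (i, j)) (by simp [pairs, hij]) ?_
      simp only
      rw [sgn_eq_ite (hx.ne hij.ne), sgn_eq_ite hij.ne]
      by_cases h1 : T.Adj (x i) (x j) <;> by_cases h2 : F.Adj i j <;> simp_all
    have h' : ¬ (T.Adj (x i) (x j) ↔ F.Adj i j) := by tauto
    rcases lt_trichotomy i j with hij | rfl | hij
    · exact key i j hij h'
    · exact absurd (iff_of_false (T.loopless _) (F.loopless _)) h'
    · refine key j i hij fun e => h' ?_
      rw [T.exactly_one _ _ (hx.ne hij.ne'), F.exactly_one _ _ hij.ne', e]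

open Classical in
lemma card_embedding_eq_sum {k : ℕ} (F : Tournament (Fin k)) :
    (Nat.card (F.Adj ↪r T.Adj) : ℝ) =
      ∑ x : Fin k → V with Function.Injective x, T.copyWeight F x := by
  rw [Finset.sum_congr rfl fun x hx => T.copyWeight_eq F (Finset.mem_filter.1 hx).2,
    ← Finset.sum_filter, Finset.filter_filter, Finset.sum_const, nsmul_eq_mul, mul_one,
    ← Fintype.card_subtype, ← Nat.card_eq_fintype_card]
  congr 1
  refine Nat.card_congr
    { toFun := fun e => ⟨e, e.injective, fun i j => e.map_rel_iff⟩
      invFun := fun x => ⟨⟨x.1, x.2.1⟩, x.2.2 _ _⟩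
      left_inv := fun e => rfl
      right_inv := fun x => rfl }

/-- The Fourier expansion of the number of labelled copies. -/
lemma sum_copyWeight {k : ℕ} (F : Tournament (Fin k)) :
    2 ^ k.choose 2 * ∑ x, T.copyWeight F x =
      ∑ D ∈ (pairs k).powerset, (∏ e ∈ D, F.sgn e.1 e.2) * ∑ x, T.signProd D x := by
  simp only [Finset.mul_sum]
  rw [Finset.sum_comm]
  refine Finset.sum_congr rfl fun x _ => ?_
  unfold copyWeight signProd
  rw [Finset.prod_div_distrib, Finset.prod_const, card_pairs, Finset.prod_one_add]
  simp only [Finset.prod_mul_distrib]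
  field_simp

lemma abs_sum_copyWeight_sub_le {k : ℕ} (F : Tournament (Fin k)) {δ : ℝ} (hδ : 0 ≤ δ)
    (h : T.energy ≤ δ ^ 4 * (Fintype.card V : ℝ) ^ 4) :
    |∑ x, T.copyWeight F x - (Fintype.card V : ℝ) ^ k / 2 ^ k.choose 2| ≤
      δ * (Fintype.card V : ℝ) ^ k := by
  have h1 := T.sum_copyWeight F
  rw [← Finset.add_sum_erase _ _ (Finset.empty_mem_powerset (pairs k))] at h1
  have h2 : |∑ D ∈ (pairs k).powerset.erase ∅,
      (∏ e ∈ D, F.sgn e.1 e.2) * ∑ x, T.signProd D x| ≤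
      2 ^ k.choose 2 * (δ * (Fintype.card V : ℝ) ^ k) := by
    refine (Finset.abs_sum_le_sum_abs _ _).trans ?_
    refine (Finset.sum_le_card_nsmul _ _ (δ * (Fintype.card V : ℝ) ^ k) fun D hD => ?_).trans ?_
    · obtain ⟨hne, hD⟩ := Finset.mem_erase.1 hD
      rw [abs_mul]
      refine (mul_le_of_le_one_left (abs_nonneg _) (F.abs_signProd_le D id)).trans ?_
      exact T.abs_sum_signProd_le (Finset.mem_powerset.1 hD)
        (Finset.nonempty_iff_ne_empty.2 hne) hδ h
    · rw [nsmul_eq_mul]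
      refine mul_le_mul_of_nonneg_right ?_ (by positivity)
      have := Finset.card_erase_le (s := (pairs k).powerset) (a := ∅)
      rw [Finset.card_powerset, card_pairs] at this
      exact_mod_cast this
  have h3 : ∑ x : Fin k → V, T.signProd ∅ x = (Fintype.card V : ℝ) ^ k := by
    simp [signProd]
  rw [h3, Finset.prod_empty, one_mul] at h1
  have h4 : (0 : ℝ) < 2 ^ k.choose 2 := by positivity
  have h5 : ∑ x, T.copyWeight F x - (Fintype.card V : ℝ) ^ k / 2 ^ k.choose 2 =
      (∑ D ∈ (pairs k).powerset.erase ∅,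
      (∏ e ∈ D, F.sgn e.1 e.2) * ∑ x, T.signProd D x) / 2 ^ k.choose 2 := by
    field_simp
    linarith
  rw [h5, abs_div, abs_of_pos h4, div_le_iff₀ h4]
  linarith

/-- The counting lemma: densities are close to those of a random tournament when the energy is
small. -/
lemma abs_density_sub_phiQR_le {k : ℕ} (F : Tournament (Fin k)) (hk : k ≤ Fintype.card V)
    (hV : 0 < Fintype.card V) {δ : ℝ} (hδ : 0 ≤ δ)
    (h : T.energy ≤ δ ^ 4 * (Fintype.card V : ℝ) ^ 4) :
    |F.density T - phiQR k F| ≤ k.factorial * (δ + 2 * k ^ 2 / Fintype.card V) := by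
  classical
  set n : ℝ := (Fintype.card V : ℝ) with hn
  have hn0 : 0 < n := by rw [hn]; exact_mod_cast hV
  set N : ℝ := (Nat.card (F.Adj ↪r T.Adj) : ℝ) with hN
  have hd0 : (0 : ℝ) < (Fintype.card V).descFactorial k := by
    exact_mod_cast Nat.descFactorial_pos.2 hk
  set d : ℝ := ((Fintype.card V).descFactorial k : ℝ) with hd
  have hN0 : 0 ≤ N := by positivity
  have hNd : N ≤ d := by
    rw [hN, T.card_embedding_eq_sum F, hd, ← card_injective_fun]
    refine (Finset.sum_le_card_nsmul _ _ 1 fun x _ =>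
      (le_abs_self _).trans (T.abs_copyWeight_le F x)).trans ?_
    simp
  have hdn : d ≤ n ^ k := by rw [hd, hn]; exact_mod_cast Nat.descFactorial_le_pow _ _
  have hpow : k ^ 2 * n ^ (k - 1) ≤ k ^ 2 / n * n ^ k := by
    rcases Nat.eq_zero_or_pos k with rfl | hk
    · simp
    · obtain ⟨j, rfl⟩ : ∃ j, k = j + 1 := ⟨k - 1, by omega⟩
      rw [Nat.add_sub_cancel, pow_succ n j]
      apply le_of_eq
      field_simp
  have hdn' : n ^ k - d ≤ k ^ 2 / n * n ^ k := by
    have := descFactorial_ge (Fintype.card V) k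
    linarith
  have h1 := T.abs_sum_copyWeight_sub_le F hδ h
  have h2 := abs_sum_sub_sum_injective_le (fun x => T.copyWeight F x) (M := 1)
    (fun x => T.abs_copyWeight_le F x) zero_le_one
  rw [← T.card_embedding_eq_sum F, one_mul] at h2
  have h3 : |N / n ^ k - 1 / 2 ^ k.choose 2| ≤ δ + k ^ 2 / n := by
    have : N / n ^ k - 1 / 2 ^ k.choose 2 = (N - n ^ k / 2 ^ k.choose 2) / n ^ k := by
      field_simp
    rw [this, abs_div, abs_of_pos (pow_pos hn0 k), div_le_iff₀ (pow_pos hn0 k)]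
    rw [abs_le] at *
    constructor <;> linarith [h1.1, h1.2, h2.1, h2.2]
  have h4 : |N / d - N / n ^ k| ≤ k ^ 2 / n := by
    have : N / d - N / n ^ k = N / d * ((n ^ k - d) / n ^ k) := by
      field_simp
    have h5 : 0 ≤ (n ^ k - d) / n ^ k := div_nonneg (by linarith) (by positivity)
    rw [this, abs_of_nonneg (mul_nonneg (by positivity) h5)]
    calc N / d * ((n ^ k - d) / n ^ k) ≤ 1 * ((n ^ k - d) / n ^ k) :=
          mul_le_mul_of_nonneg_right ((div_le_one hd0).2 hNd) h5
      _ ≤ k ^ 2 / n := by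
          rw [one_mul, div_le_iff₀ (pow_pos hn0 k)]
          exact hdn'
  have ha : (1 : ℝ) ≤ Nat.card (F.Adj ≃r F.Adj) := by exact_mod_cast card_aut_pos F
  have h6 : F.density T - phiQR k F = (k.factorial / Nat.card (F.Adj ≃r F.Adj) : ℝ) *
      ((N / d - N / n ^ k) + (N / n ^ k - 1 / 2 ^ k.choose 2)) := by
    rw [density_eq F T hk, ← hN, ← hd]
    unfold phiQR
    field_simp
    ring
  rw [h6, abs_mul, abs_of_nonneg (by positivity)]
  refine mul_le_mul (div_le_self (by positivity) ha) ?_ (abs_nonneg _) (by positivity)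
  refine (abs_add_le _ _).trans ?_
  have : 2 * (k : ℝ) ^ 2 / n = k ^ 2 / n + k ^ 2 / n := by ring
  linarith

end Counting

/-! ### Stability -/

lemma card_aut_T58 : Nat.card (T58.Adj ≃r T58.Adj) = 1 := by
  have h : ∀ e : Equiv.Perm (Fin 5), (∀ i j, T58.Adj (e i) (e j) ↔ T58.Adj i j) → e = 1 := by
    decide +kernel
  rw [Nat.card_eq_one_iff_unique]
  refine ⟨⟨fun e e' => ?_⟩, ⟨RelIso.refl _⟩⟩
  have h1 := h e.toEquiv fun i j => e.map_rel_iff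
  have h2 := h e'.toEquiv fun i j => e'.map_rel_iff
  exact RelIso.toEquiv_injective (h1.trans h2.symm)

lemma phiQR_T58 : phiQR 5 T58 = 15 / 128 := by
  rw [phiQR, card_aut_T58]
  norm_num [Nat.factorial, Nat.choose]

section Upper
variable {V : Type*} [Fintype V] (T : Tournament V)

/-- The density of `T₅⁸` falls below `15 / 128` by a multiple of the energy, up to `O(1 / n)`. -/
lemma density_T58_le (hV : 50 ≤ Fintype.card V) :
    T58.density T ≤ 15 / 128 - 9 / 128 * (T.energy / (Fintype.card V : ℝ) ^ 4) +
      1400 / Fintype.card V := by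
  have h1 := T.card_embedding_T58_le
  have h2 := descFactorial_ge (Fintype.card V) 5
  have h3 : ((Fintype.card V).descFactorial 5 : ℝ) ≤ (Fintype.card V : ℝ) ^ 5 := by
    exact_mod_cast Nat.descFactorial_le_pow _ _
  have hE := T.energy_nonneg
  have hn : (50 : ℝ) ≤ Fintype.card V := by exact_mod_cast hV
  rw [density_eq T58 T (by omega), card_aut_T58]
  set n : ℝ := (Fintype.card V : ℝ)
  set N : ℝ := (Nat.card (T58.Adj ↪r T.Adj) : ℝ)
  set d : ℝ := ((Fintype.card V).descFactorial 5 : ℝ)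
  have hn0 : 0 < n := by linarith
  have hn4 : 0 < n ^ 4 := by positivity
  have hd : n ^ 5 / 2 ≤ d := by
    norm_num at h2
    nlinarith
  have hd0 : 0 < d := lt_of_lt_of_le (by positivity) hd
  have h4 : T.energy / n ^ 4 ≤ n * T.energy / d := by
    rw [div_le_div_iff₀ hn4 hd0]
    nlinarith [mul_le_mul_of_nonneg_left h3 hE]
  have h5 : n ^ 4 / d ≤ 2 / n := by
    rw [div_le_div_iff₀ hd0 hn0]
    nlinarith
  have h6 : 46080 * (N / d) ≤ 45 - 27 * (n * T.energy / d) + 250000 * (n ^ 4 / d) := by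
    have : 45 - 27 * (n * T.energy / d) + 250000 * (n ^ 4 / d) =
        (45 * d - 27 * (n * T.energy) + 250000 * n ^ 4) / d := by field_simp
    rw [this, ← mul_div_assoc]
    exact div_le_div_of_nonneg_right h1 hd0.le
  have h7 : 2 / n = 2 * (1 / n) := by ring
  have h8 : 1400 / n = 1400 * (1 / n) := by ring
  rw [h7] at h5
  rw [h8]
  norm_num [Nat.factorial] at h5 ⊢
  linarith [inv_pos.2 hn0]

end Upper

/-- A tournament in which `T₅⁸` has density close to `15 / 128` has all densities close to the
quasi-random ones. -/
lemma exists_abs_density_sub_phiQR_le {k : ℕ} (F : Tournament (Fin k)) {ε : ℝ} (hε : 0 < ε) :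
    ∃ C₁ C₂ : ℝ, ∀ (n : ℕ) (T : Tournament (Fin n)), 50 ≤ n → k ≤ n →
      |F.density T - phiQR k F| ≤ ε + C₁ * (15 / 128 - T58.density T) + C₂ / n := by
  have hk0 : (0 : ℝ) < k.factorial := by exact_mod_cast k.factorial_pos
  -- the counting lemma is applied with `δ = η + t / η ^ 3 ≥ t ^ (1 / 4)`, `t` the scaled energy
  set η : ℝ := ε / k.factorial with hη
  have hη0 : 0 < η := by positivity
  refine ⟨k.factorial / η ^ 3 * (128 / 9), k.factorial / η ^ 3 * (128 / 9) * 1400 +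
    k.factorial * (2 * k ^ 2), fun n T hn hkn => ?_⟩
  have hn0 : (0 : ℝ) < n := by exact_mod_cast (by omega : 0 < n)
  set t : ℝ := T.energy / (n : ℝ) ^ 4 with ht
  have ht0 : 0 ≤ t := div_nonneg T.energy_nonneg (by positivity)
  have h1 := T.density_T58_le (by simpa using hn)
  rw [Fintype.card_fin, ← ht] at h1
  have h2 := T.abs_density_sub_phiQR_le F (by simpa using hkn) (by simp; omega)
    (δ := η + t / η ^ 3) (by positivity) (by
      rw [Fintype.card_fin, ← div_le_iff₀ (by positivity), ← ht]
      set s := t / η ^ 3 with hs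
      have hs0 : 0 ≤ s := by positivity
      have hts : t = s * η ^ 3 := by rw [hs]; field_simp
      have : (η + s) ^ 4 = s * η ^ 3 + (3 * (s * η ^ 3) + η ^ 4 + 6 * η ^ 2 * s ^ 2 +
          4 * η * s ^ 3 + s ^ 4) := by ring
      rw [this, hts]
      have : 0 ≤ 3 * (s * η ^ 3) + η ^ 4 + 6 * η ^ 2 * s ^ 2 + 4 * η * s ^ 3 + s ^ 4 := by
        positivity
      linarith)
  rw [Fintype.card_fin] at h2
  refine h2.trans ?_
  have h3 : t ≤ 128 / 9 * (15 / 128 - T58.density T + 1400 / n) := by linarith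
  have h4 : k.factorial * (η + t / η ^ 3 + 2 * k ^ 2 / n) =
      ε + k.factorial / η ^ 3 * t + k.factorial * (2 * k ^ 2) / n := by
    rw [hη]; field_simp
  rw [h4]
  have h5 := mul_le_mul_of_nonneg_left h3 (by positivity : 0 ≤ k.factorial / η ^ 3)
  have h6 : (k.factorial / η ^ 3 * (128 / 9) * 1400 + k.factorial * (2 * k ^ 2)) / n =
    k.factorial / η ^ 3 * (128 / 9) * (1400 / n) + k.factorial * (2 * k ^ 2) / n := by ring
  rw [h6]
  linarith

lemma convergesTo_phiQR_of_tendsto {s : ℕ → ℕ} (hs : Tendsto s atTop atTop)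
    (T : ∀ n, Tournament (Fin (s n)))
    (h : Tendsto (fun n => T58.density (T n)) atTop (𝓝 (15 / 128))) :
    ConvergesTo T phiQR := by
  intro k F
  rw [Metric.tendsto_atTop']
  intro ε hε
  obtain ⟨C₁, C₂, hC⟩ := exists_abs_density_sub_phiQR_le F (half_pos hε)
  have hs' : Tendsto (fun n => (s n : ℝ)) atTop atTop := tendsto_natCast_atTop_atTop.comp hs
  have hlim : Tendsto (fun n => ε / 2 + C₁ * (15 / 128 - T58.density (T n)) + C₂ / s n) atTop
      (𝓝 (ε / 2 + C₁ * (15 / 128 - 15 / 128) + 0)) :=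
    (tendsto_const_nhds.add ((tendsto_const_nhds.sub h).const_mul C₁)).add
      (hs'.const_div_atTop C₂)
  have h1 := hlim.eventually
    (gt_mem_nhds (by linarith : ε / 2 + C₁ * (15 / 128 - 15 / 128) + 0 < ε))
  obtain ⟨n, hn⟩ := eventually_atTop.1 (h1.and ((hs.eventually_ge_atTop 50).and
    (hs.eventually_ge_atTop k)))
  refine ⟨n, fun m hm => ?_⟩
  obtain ⟨h2, h3, h4⟩ := hn m (le_of_lt hm)
  rw [Real.dist_eq]
  exact (hC _ (T m) h3 h4).trans_lt h2

/-- Small energy implies convergence to the quasi-random densities. -/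
lemma convergesTo_phiQR_of_energy {s : ℕ → ℕ} (hs : Tendsto s atTop atTop)
    (T : ∀ n, Tournament (Fin (s n)))
    (h : Tendsto (fun n => (T n).energy / (s n : ℝ) ^ 4) atTop (𝓝 0)) :
    ConvergesTo T phiQR := by
  intro k F
  rw [Metric.tendsto_atTop']
  intro ε hε
  have hk0 : (0 : ℝ) < k.factorial := by exact_mod_cast k.factorial_pos
  set δ : ℝ := ε / (2 * k.factorial) with hδ
  have hδ0 : 0 < δ := by positivity
  have hs' : Tendsto (fun n => (s n : ℝ)) atTop atTop := tendsto_natCast_atTop_atTop.comp hs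
  have hlim : Tendsto (fun n => k.factorial * (δ + 2 * k ^ 2 / s n)) atTop
      (𝓝 (k.factorial * (δ + 0))) :=
    (tendsto_const_nhds.add (hs'.const_div_atTop _)).const_mul _
  have hlt : k.factorial * (δ + 0) < ε := by
    have : k.factorial * (δ + 0) = ε / 2 := by rw [hδ]; field_simp; ring
    linarith
  obtain ⟨n, hn⟩ := eventually_atTop.1 ((hlim.eventually (gt_mem_nhds hlt)).and
    ((h.eventually (gt_mem_nhds (by positivity : (0 : ℝ) < δ ^ 4))).and
      ((hs.eventually_ge_atTop 1).and (hs.eventually_ge_atTop k))))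
  refine ⟨n, fun m hm => ?_⟩
  obtain ⟨h2, h3, h4, h5⟩ := hn m (le_of_lt hm)
  have hsm : (0 : ℝ) < s m := by exact_mod_cast (by omega : 0 < s m)
  rw [Real.dist_eq]
  have := (T m).abs_density_sub_phiQR_le F (by simpa using h5) (by simp; omega) hδ0.le (by
    rw [Fintype.card_fin, ← div_le_iff₀ (by positivity)]
    exact h3.le)
  rw [Fintype.card_fin] at this
  exact this.trans_lt h2

/-! ### Positive homomorphisms -/

namespace IsPosHom
variable {φ : ∀ k, Tournament (Fin k) → ℝ} (hφ : IsPosHom φ)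
include hφ

/-- The values on the tournaments of size `l` form a probability distribution: this is the relation
that expands the empty tournament, whose density is `1` everywhere. -/
lemma sum_rep (l : ℕ) : ∑ c : IsoClass l, φ l c.rep = 1 := by
  have F : Tournament (Fin 0) := ⟨⟨fun _ _ => False⟩, fun i => i.elim0, fun i => i.elim0⟩
  have h := hφ.map_rel 0 l F (Nat.zero_le l)
  rw [hφ.map_one] at h
  rw [h]
  refine Finset.sum_congr rfl fun c _ => ?_
  have h1 := density_mul_card_aut F c.rep
  have h2 : Nat.card (F.Adj ≃r F.Adj) = 1 := by
    rw [Nat.card_eq_one_iff_unique]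
    exact ⟨⟨fun e e' => RelIso.ext fun i => i.elim0⟩, ⟨RelIso.refl _⟩⟩
  have h3 : Nat.card (F.Adj ↪r c.rep.Adj) = 1 := by
    rw [Nat.card_eq_one_iff_unique]
    exact ⟨⟨fun e e' => RelEmbedding.ext fun i => i.elim0⟩,
      ⟨⟨⟨fun i => i.elim0, fun i => i.elim0⟩, fun {i} => i.elim0⟩⟩⟩
  rw [h2, h3] at h1
  simp at h1
  rw [h1, one_mul]

lemma map_T58_le_add {l : ℕ} (hl : 50 ≤ l) : φ 5 T58 ≤ 15 / 128 + 1400 / l := by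
  rw [hφ.map_rel 5 l T58 (by omega)]
  calc ∑ c : IsoClass l, T58.density c.rep * φ l c.rep
      ≤ ∑ c : IsoClass l, (15 / 128 + 1400 / l) * φ l c.rep := by
        refine Finset.sum_le_sum fun c _ =>
          mul_le_mul_of_nonneg_right ?_ (hφ.mem_Icc l c.rep).1
        have h := c.rep.density_T58_le (by simpa using hl)
        have := c.rep.energy_nonneg
        rw [Fintype.card_fin] at h
        have : 0 ≤ 9 / 128 * (c.rep.energy / (l : ℝ) ^ 4) := by positivity
        linarith
    _ = 15 / 128 + 1400 / l := by rw [← Finset.mul_sum, hφ.sum_rep, mul_one]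

lemma map_T58_le : φ 5 T58 ≤ 15 / 128 := by
  have h : Tendsto (fun l : ℕ => (15 / 128 + 1400 / l : ℝ)) atTop (𝓝 (15 / 128 + 0)) :=
    tendsto_const_nhds.add (tendsto_natCast_atTop_atTop.const_div_atTop _)
  rw [add_zero] at h
  exact ge_of_tendsto h (eventually_atTop.2 ⟨50, fun l hl => hφ.map_T58_le_add hl⟩)

/-- Averaging the stability estimate over a random tournament of size `l` with law `φ`. -/
lemma eq_phiQR (h : φ 5 T58 = 15 / 128) : φ = phiQR := by
  funext k F
  rw [← sub_eq_zero, ← abs_nonpos_iff]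
  refine le_of_forall_pos_le_add fun ε hε => ?_
  obtain ⟨C₁, C₂, hC⟩ := exists_abs_density_sub_phiQR_le F hε
  have key : ∀ l : ℕ, 50 ≤ l → k ≤ l → |φ k F - phiQR k F| ≤ ε + C₂ / l := by
    intro l hl hkl
    have h1 : φ k F - phiQR k F =
        ∑ c : IsoClass l, (F.density c.rep - phiQR k F) * φ l c.rep := by
      simp only [sub_mul, Finset.sum_sub_distrib]
      rw [← hφ.map_rel k l F hkl, ← Finset.mul_sum, hφ.sum_rep, mul_one]
    rw [h1]
    calc |∑ c : IsoClass l, (F.density c.rep - phiQR k F) * φ l c.rep|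
        ≤ ∑ c : IsoClass l, (ε + C₁ * (15 / 128 - T58.density c.rep) + C₂ / l) * φ l c.rep := by
          refine (Finset.abs_sum_le_sum_abs _ _).trans (Finset.sum_le_sum fun c _ => ?_)
          rw [abs_mul, abs_of_nonneg (hφ.mem_Icc l c.rep).1]
          exact mul_le_mul_of_nonneg_right (hC l c.rep hl hkl) (hφ.mem_Icc l c.rep).1
      _ = ∑ c : IsoClass l, ((ε + C₁ * (15 / 128) + C₂ / l) * φ l c.rep -
            C₁ * (T58.density c.rep * φ l c.rep)) := by
          refine Finset.sum_congr rfl fun c _ => by ring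
      _ = ε + C₂ / l := by
          rw [Finset.sum_sub_distrib, ← Finset.mul_sum, ← Finset.mul_sum, hφ.sum_rep,
            ← hφ.map_rel 5 l T58 (by omega), h]
          ring
  have hlim : Tendsto (fun l : ℕ => (ε + C₂ / l : ℝ)) atTop (𝓝 (ε + 0)) :=
    tendsto_const_nhds.add (tendsto_natCast_atTop_atTop.const_div_atTop _)
  rw [add_zero] at hlim
  rw [zero_add]
  exact ge_of_tendsto hlim (eventually_atTop.2 ⟨max 50 k, fun l hl =>
    key l (le_trans (le_max_left _ _) hl) (le_trans (le_max_right _ _) hl)⟩)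

end IsPosHom

/-! ### The energy of a random tournament -/

section Flip
variable {V : Type*}

/-- Reversing the arc between `p` and `q`. -/
def flip (S : Tournament V) (p q : V) : Tournament V where
  Adj x y := ((x = p ∧ y = q ∨ x = q ∧ y = p) ∧ S.Adj y x) ∨
    (¬ (x = p ∧ y = q ∨ x = q ∧ y = p) ∧ S.Adj x y)
  loopless x := by
    have := S.loopless x
    tauto
  exactly_one x y h := by
    have h1 := S.exactly_one x y h
    have h2 := S.exactly_one y x h.symm
    tauto

lemma flip_flip (S : Tournament V) (p q : V) : (S.flip p q).flip p q = S := by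
  ext x y
  change (((x = p ∧ y = q ∨ x = q ∧ y = p) ∧ _) ∨ _) ↔ _
  simp only [flip]
  tauto

lemma sgn_congr {W : Type*} {S : Tournament V} {T : Tournament W} {x y : V} {a b : W}
    (h : S.Adj x y ↔ T.Adj a b) (h' : S.Adj y x ↔ T.Adj b a) : S.sgn x y = T.sgn a b := by
  by_cases h1 : T.Adj a b <;> by_cases h2 : T.Adj b a <;> simp [sgn, h, h', h1, h2]

lemma sgn_flip_self (S : Tournament V) (p q : V) : (S.flip p q).sgn p q = - S.sgn p q := by
  rw [← S.sgn_symm p q]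
  have h1 : (S.flip p q).Adj p q ↔ S.Adj q p := by simp only [flip]; tauto
  have h2 : (S.flip p q).Adj q p ↔ S.Adj p q := by simp only [flip]; tauto
  exact sgn_congr h1 h2

lemma sgn_flip_of_ne (S : Tournament V) {p q x y : V} (h : ¬ (x = p ∧ y = q))
    (h' : ¬ (x = q ∧ y = p)) : (S.flip p q).sgn x y = S.sgn x y := by
  have h1 : (S.flip p q).Adj x y ↔ S.Adj x y := by simp only [flip]; tauto
  have h2 : (S.flip p q).Adj y x ↔ S.Adj y x := by simp only [flip]; tauto
  exact sgn_congr h1 h2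

/-- The product of the signs along the four arcs joining `x, y` to `u, v`. -/
noncomputable def walk (S : Tournament V) (z : V × V × V × V) : ℝ :=
  S.sgn z.1 z.2.2.1 * S.sgn z.2.1 z.2.2.1 * (S.sgn z.1 z.2.2.2 * S.sgn z.2.1 z.2.2.2)

/-- The vertices of a quadruple. -/
def vertices [DecidableEq V] (z : V × V × V × V) : Finset V := {z.1, z.2.1, z.2.2.1, z.2.2.2}

lemma abs_walk_le (S : Tournament V) (z : V × V × V × V) : |S.walk z| ≤ 1 :=
  abs_mul_le_one (abs_mul_le_one (S.abs_sgn_le _ _) (S.abs_sgn_le _ _))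
    (abs_mul_le_one (S.abs_sgn_le _ _) (S.abs_sgn_le _ _))

lemma energy_eq_sum_walk [Fintype V] (S : Tournament V) : S.energy = ∑ z, S.walk z := by
  simp only [energy, codeg, sq, Finset.sum_mul_sum, walk, Fintype.sum_prod_type]

lemma walk_flip_of_not_mem [DecidableEq V] (S : Tournament V) {p q : V} {z : V × V × V × V}
    (h : p ∉ vertices z ∨ q ∉ vertices z) :
    (S.flip p q).walk z = S.walk z := by
  simp only [vertices, Finset.mem_insert, Finset.mem_singleton] at h
  unfold walk
  rw [sgn_flip_of_ne, sgn_flip_of_ne, sgn_flip_of_ne, sgn_flip_of_ne] <;>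
    · rintro ⟨h1, h2⟩
      subst h1 h2
      simp at h

/-- Reversing `xu` changes the sign of a nondegenerate product: the other three arcs differ from
`xu` unless `y = u`, when the product vanishes. -/
lemma walk_flip (S : Tournament V) {x y u v : V} (hxy : x ≠ y) (huv : u ≠ v) (hxu : x ≠ u) :
    (S.flip x u).walk (x, y, u, v) = - S.walk (x, y, u, v) := by
  unfold walk
  simp only
  rcases eq_or_ne y u with rfl | hyu
  · simp
  rw [sgn_flip_self, S.sgn_flip_of_ne (x := y) (y := u) (by tauto) (by tauto),
    S.sgn_flip_of_ne (x := x) (y := v) (by tauto) (by tauto),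
    S.sgn_flip_of_ne (x := y) (y := v) (by tauto) (by tauto)]
  ring

end Flip

section Moment
variable {n : ℕ}

noncomputable instance : Fintype (Tournament (Fin n)) := Fintype.ofFinite _

lemma card_tournament_pos : 0 < Fintype.card (Tournament (Fin n)) :=
  Fintype.card_pos_iff.2 ⟨{ Adj := fun i j => i < j
                            loopless := fun i => lt_irrefl i
                            exactly_one := fun _ _ h =>
                              ⟨fun h' => h'.asymm, fun h' => lt_of_le_of_ne (not_lt.1 h') h⟩ }⟩

lemma sum_walk_mul_walk_eq_zero {x y u v : Fin n} (hxy : x ≠ y) (huv : u ≠ v)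
    {z : Fin n × Fin n × Fin n × Fin n}
    (h : x ∉ vertices z ∨ u ∉ vertices z) :
    ∑ S : Tournament (Fin n), S.walk (x, y, u, v) * S.walk z = 0 := by
  rcases eq_or_ne x u with rfl | hxu
  · simp [walk]
  · have hinv : Function.Involutive (fun S : Tournament (Fin n) => S.flip x u) :=
      fun S => S.flip_flip x u
    have := Equiv.sum_comp hinv.toPerm
      (fun S : Tournament (Fin n) => S.walk (x, y, u, v) * S.walk z)
    simp only [Function.Involutive.coe_toPerm, walk_flip _ hxy huv hxu,
      walk_flip_of_not_mem _ h, neg_mul, Finset.sum_neg_distrib] at this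
    linarith

/-- The quadruples `(x, y, u, v)` with `x ≠ y` and `u ≠ v`. -/
def nondegenerate (n : ℕ) : Finset (Fin n × Fin n × Fin n × Fin n) :=
  Finset.univ.filter fun z => z.1 ≠ z.2.1 ∧ z.2.2.1 ≠ z.2.2.2

/-- The contribution to the energy of the nondegenerate quadruples. -/
noncomputable def mainEnergy (S : Tournament (Fin n)) : ℝ := ∑ z ∈ nondegenerate n, S.walk z

lemma energy_le_mainEnergy_add (S : Tournament (Fin n)) :
    S.energy ≤ S.mainEnergy + 2 * (n : ℝ) ^ 3 := by
  rw [energy_eq_sum_walk, mainEnergy, nondegenerate, Finset.sum_filter]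
  have h : ∀ z : Fin n × Fin n × Fin n × Fin n, S.walk z ≤
      (if z.1 ≠ z.2.1 ∧ z.2.2.1 ≠ z.2.2.2 then S.walk z else 0) +
        ((if z.1 = z.2.1 then 1 else 0) + (if z.2.2.1 = z.2.2.2 then 1 else 0)) := by
    intro z
    have := (abs_le.1 (S.abs_walk_le z)).2
    by_cases h1 : z.1 = z.2.1 <;> by_cases h2 : z.2.2.1 = z.2.2.2 <;> simp [h1, h2] <;> linarith
  refine (Finset.sum_le_sum fun z _ => h z).trans ?_
  rw [Finset.sum_add_distrib, Finset.sum_add_distrib]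
  have h1 : ∑ z : Fin n × Fin n × Fin n × Fin n, (if z.1 = z.2.1 then 1 else 0 : ℝ) =
      (n : ℝ) ^ 3 := by
    calc _ = ∑ x : Fin n, ∑ y : Fin n, ∑ _u : Fin n, ∑ _v : Fin n,
          (if x = y then 1 else 0 : ℝ) := by simp only [Fintype.sum_prod_type]
      _ = _ := by
        simp only [Finset.sum_const, Finset.card_univ, Fintype.card_fin, nsmul_eq_mul, mul_ite,
          mul_one, mul_zero, Finset.sum_ite_eq, Finset.mem_univ, if_true]
        ring
  have h2 : ∑ z : Fin n × Fin n × Fin n × Fin n, (if z.2.2.1 = z.2.2.2 then 1 else 0 : ℝ) =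
      (n : ℝ) ^ 3 := by
    simp only [Fintype.sum_prod_type, Finset.sum_const, Finset.card_univ, Fintype.card_fin,
      nsmul_eq_mul, Finset.sum_ite_eq, Finset.mem_univ, if_true]
    ring
  rw [h1, h2]
  linarith

/-- The second moment of the energy of a uniformly random tournament. Only pairs of quadruples such
that the vertices of one are among those of the other correlate, hence the order `n ^ 4` instead
of `n ^ 8`. -/
lemma sum_mainEnergy_sq_le :
    ∑ S : Tournament (Fin n), S.mainEnergy ^ 2 ≤
      256 * (n : ℝ) ^ 4 * Fintype.card (Tournament (Fin n)) := by
  let B : Fin n × Fin n × Fin n × Fin n → Finset (Fin n × Fin n × Fin n × Fin n) :=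
    fun z => vertices z ×ˢ vertices z ×ˢ vertices z ×ˢ vertices z
  have hB : ∀ z, (B z).card ≤ 256 := by
    intro z
    have hA : (vertices z).card ≤ 4 := Finset.card_le_four
    simp only [B, Finset.card_product]
    calc _ ≤ 4 * (4 * (4 * 4)) := by gcongr
      _ = 256 := by norm_num
  have hzero : ∀ z w : Fin n × Fin n × Fin n × Fin n, w ∈ nondegenerate n → w ∉ B z →
      ∑ S : Tournament (Fin n), S.walk w * S.walk z = 0 := by
    rintro z ⟨x, y, u, v⟩ hw hwB
    obtain ⟨-, hxy, huv⟩ := Finset.mem_filter.1 hw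
    simp only [B, Finset.mem_product] at hwB
    by_cases h : x ∉ vertices z ∨ u ∉ vertices z
    · exact sum_walk_mul_walk_eq_zero hxy huv h
    · have h' : y ∉ vertices z ∨ v ∉ vertices z := by tauto
      rw [← sum_walk_mul_walk_eq_zero hxy.symm huv.symm h']
      refine Finset.sum_congr rfl fun S _ => ?_
      simp only [walk]
      ring
  have hbound : ∀ z w : Fin n × Fin n × Fin n × Fin n,
      ∑ S : Tournament (Fin n), S.walk w * S.walk z ≤ Fintype.card (Tournament (Fin n)) := by
    intro z w
    refine (Finset.sum_le_card_nsmul _ _ 1 fun S _ => (le_abs_self _).trans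
      (abs_mul_le_one (S.abs_walk_le w) (S.abs_walk_le z))).trans ?_
    simp
  calc ∑ S : Tournament (Fin n), S.mainEnergy ^ 2
      = ∑ z ∈ nondegenerate n, ∑ w ∈ nondegenerate n,
          ∑ S : Tournament (Fin n), S.walk w * S.walk z := by
        simp only [mainEnergy, sq, Finset.sum_mul_sum]
        rw [Finset.sum_comm]
        refine Finset.sum_congr rfl fun z _ => ?_
        rw [Finset.sum_comm]
        exact Finset.sum_congr rfl fun w _ => Finset.sum_congr rfl fun S _ => mul_comm _ _
    _ ≤ ∑ z ∈ nondegenerate n, 256 * (Fintype.card (Tournament (Fin n)) : ℝ) := by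
        refine Finset.sum_le_sum fun z _ => ?_
        rw [← Finset.sum_filter_of_ne (p := fun w => w ∈ B z) (fun w hw hne => by
          by_contra h; exact hne (hzero z w hw h))]
        refine (Finset.sum_le_card_nsmul _ _ _ fun w _ => hbound z w).trans ?_
        rw [nsmul_eq_mul]
        refine mul_le_mul_of_nonneg_right ?_ (by positivity)
        have : (Finset.filter (fun w => w ∈ B z) (nondegenerate n)).card ≤ (B z).card :=
          Finset.card_le_card fun w hw => (Finset.mem_filter.1 hw).2
        exact_mod_cast this.trans (hB z)
    _ ≤ 256 * (n : ℝ) ^ 4 * Fintype.card (Tournament (Fin n)) := by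
        rw [Finset.sum_const, nsmul_eq_mul]
        have h1 : (nondegenerate n).card ≤ n ^ 4 := by
          refine (Finset.card_le_univ _).trans (le_of_eq ?_)
          simp only [Fintype.card_prod, Fintype.card_fin]
          ring
        have h2 : ((nondegenerate n).card : ℝ) ≤ (n : ℝ) ^ 4 := by exact_mod_cast h1
        have h3 : (0 : ℝ) ≤ 256 * (Fintype.card (Tournament (Fin n)) : ℝ) := by positivity
        nlinarith [mul_le_mul_of_nonneg_right h2 h3]

/-- Some tournament has an energy no larger than expected. -/
lemma exists_energy_le (n : ℕ) :
    ∃ S : Tournament (Fin n), S.energy ≤ 2 * (n : ℝ) ^ 3 + 16 * (n : ℝ) ^ 2 := by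
  have hpos : (0 : ℝ) < Fintype.card (Tournament (Fin n)) := by
    exact_mod_cast card_tournament_pos
  have : Nonempty (Tournament (Fin n)) := Fintype.card_pos_iff.1 card_tournament_pos
  obtain ⟨S, -, hS⟩ := Finset.exists_le_of_sum_le (s := (Finset.univ : Finset (Tournament (Fin n))))
    (f := fun S => S.mainEnergy ^ 2) (g := fun _ => 256 * (n : ℝ) ^ 4) Finset.univ_nonempty (by
      refine sum_mainEnergy_sq_le.trans (le_of_eq ?_)
      rw [Finset.sum_const, nsmul_eq_mul, Finset.card_univ, mul_comm])
  refine ⟨S, ?_⟩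
  have h1 : S.mainEnergy ≤ 16 * (n : ℝ) ^ 2 := by
    refine le_trans (le_abs_self _) (abs_le_of_sq_le_sq ?_ (by positivity))
    refine hS.trans (le_of_eq (by ring))
  have := S.energy_le_mainEnergy_add
  linarith

end Moment

/-! ### Almost sure convergence of random tournaments -/

section Random

variable {Ω : Type*} [MeasurableSpace Ω] {P : Measure Ω} [IsProbabilityMeasure P] {n : ℕ}
  {R : Ω → Tournament (Fin n)}

lemma ext_of_lt {S T : Tournament (Fin n)} (h : ∀ i j, i < j → (S.Adj i j ↔ T.Adj i j)) :
    S = T := by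
  ext i j
  rcases lt_trichotomy i j with hij | rfl | hij
  · exact h i j hij
  · exact iff_of_false (S.loopless _) (T.loopless _)
  · rw [S.exactly_one _ _ hij.ne', T.exactly_one _ _ hij.ne', h j i hij]

omit [IsProbabilityMeasure P] in
lemma IsRandomTournament.measurableSet_preimage (hR : IsRandomTournament P R)
    (S : Tournament (Fin n)) : MeasurableSet {ω | R ω = S} := by
  classical
  have : {ω | R ω = S} = ⋂ i, ⋂ j, {ω | (R ω).Adj i j ↔ S.Adj i j} := by
    ext ω
    simp only [Set.mem_ofPred_eq, Set.mem_iInter]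
    exact ⟨fun h i j => by rw [h], fun h => ext_of_lt fun i j _ => h i j⟩
  rw [this]
  refine MeasurableSet.iInter fun i => MeasurableSet.iInter fun j => ?_
  by_cases h : S.Adj i j
  · simpa [h] using hR.measurable_arc i j
  · simp only [h, iff_false]
    exact (hR.measurable_arc i j).compl

/-- A random tournament is uniformly distributed. -/
lemma IsRandomTournament.prob_eq (hR : IsRandomTournament P R) (S : Tournament (Fin n)) :
    P {ω | R ω = S} = (1 / 2) ^ Fintype.card {e : Fin n × Fin n // e.1 < e.2} := by
  classical
  have h1 : {ω | R ω = S} = ⋂ e : {e : Fin n × Fin n // e.1 < e.2},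
      if S.Adj e.1.1 e.1.2 then {ω | (R ω).Adj e.1.1 e.1.2}
        else {ω | (R ω).Adj e.1.1 e.1.2}ᶜ := by
    ext ω
    simp only [Set.mem_ofPred_eq, Set.mem_iInter]
    constructor
    · rintro rfl e
      split_ifs with h <;> simpa using h
    · refine fun h => ext_of_lt fun i j hij => ?_
      have := h ⟨(i, j), hij⟩
      simp only at this
      split_ifs at this with h'
      · exact iff_of_true this h'
      · exact iff_of_false this h'
  have hhalf : (1 : ENNReal) - 1 / 2 = 1 / 2 := by
    rw [one_div]; exact ENNReal.one_sub_inv_two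
  rw [h1, iIndep.meas_iInter hR.indep]
  · rw [← Finset.card_univ, ← Finset.prod_const]
    refine Finset.prod_congr rfl fun e _ => ?_
    split_ifs
    · exact hR.prob_arc _ _ e.2.ne
    · rw [prob_compl_eq_one_sub (hR.measurable_arc _ _), hR.prob_arc _ _ e.2.ne, hhalf]
  · intro e
    have := MeasurableSpace.measurableSet_generateFrom (s := {{ω | (R ω).Adj e.1.1 e.1.2}})
      (Set.mem_singleton _)
    split_ifs
    · exact this
    · exact this.compl

omit [IsProbabilityMeasure P] in
lemma IsRandomTournament.measurable_comp (hR : IsRandomTournament P R)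
    (G : Tournament (Fin n) → ENNReal) : Measurable fun ω => G (R ω) := by
  let _ : MeasurableSpace (Tournament (Fin n)) := ⊤
  have : Measurable R := measurable_to_countable' fun S => hR.measurableSet_preimage S
  exact (measurable_from_top (f := G)).comp this

lemma IsRandomTournament.lintegral_comp (hR : IsRandomTournament P R)
    (G : Tournament (Fin n) → ENNReal) :
    ∫⁻ ω, G (R ω) ∂P = (∑ S, G S) / Fintype.card (Tournament (Fin n)) := by
  let _ : MeasurableSpace (Tournament (Fin n)) := ⊤
  have hm : Measurable R := measurable_to_countable' fun S => hR.measurableSet_preimage S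
  have h : ∀ G : Tournament (Fin n) → ENNReal, ∫⁻ ω, G (R ω) ∂P =
      (∑ S, G S) * (1 / 2) ^ Fintype.card {e : Fin n × Fin n // e.1 < e.2} := by
    intro G
    rw [← lintegral_map measurable_from_top hm, lintegral_fintype, Finset.sum_mul]
    refine Finset.sum_congr rfl fun S _ => ?_
    rw [Measure.map_apply hm trivial]
    congr 1
    exact hR.prob_eq S
  have h1 := h 1
  simp at h1
  rw [h, div_eq_mul_inv (∑ S, G S)]
  congr 1
  rw [one_div]
  exact ENNReal.eq_inv_of_mul_eq_one_left (by rw [mul_comm]; simpa using h1.symm)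

lemma IsRandomTournament.lintegral_mainEnergy_le (hR : IsRandomTournament P R) :
    ∫⁻ ω, ENNReal.ofReal (((R ω).mainEnergy / (n : ℝ) ^ 4) ^ 2) ∂P ≤
      ENNReal.ofReal (256 * (1 / (n : ℝ) ^ 4)) := by
  have hpos : (0 : ℝ) < Fintype.card (Tournament (Fin n)) := by
    exact_mod_cast card_tournament_pos
  rw [hR.lintegral_comp (fun S => ENNReal.ofReal ((S.mainEnergy / (n : ℝ) ^ 4) ^ 2)),
    ← ENNReal.ofReal_sum_of_nonneg (fun _ _ => sq_nonneg _), ← ENNReal.ofReal_natCast,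
    ← ENNReal.ofReal_div_of_pos hpos]
  refine ENNReal.ofReal_le_ofReal ?_
  rw [div_le_iff₀ hpos]
  simp only [div_pow]
  rw [← Finset.sum_div]
  rcases Nat.eq_zero_or_pos n with rfl | hn
  · simp
  have hn' : (0 : ℝ) < n := by exact_mod_cast hn
  rw [div_le_iff₀ (by positivity)]
  refine sum_mainEnergy_sq_le.trans (le_of_eq ?_)
  field_simp

/-- The second moments of the scaled energies are summable, so the energies are `o(n ^ 4)` almost
surely, whatever the joint distribution. -/
lemma ae_convergesTo_phiQR {R : ∀ n, Ω → Tournament (Fin n)}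
    (hR : ∀ n, IsRandomTournament P (R n)) :
    ∀ᵐ ω ∂P, ConvergesTo (fun n => R n ω) phiQR := by
  have hmeas : ∀ n, Measurable fun ω =>
      ENNReal.ofReal (((R n ω).mainEnergy / (n : ℝ) ^ 4) ^ 2) := fun n =>
    (hR n).measurable_comp fun S => ENNReal.ofReal ((S.mainEnergy / (n : ℝ) ^ 4) ^ 2)
  have hsum : Summable fun n : ℕ => 256 * (1 / (n : ℝ) ^ 4) :=
    (Real.summable_one_div_nat_pow.2 (by norm_num)).mul_left _
  have hfin : ∫⁻ ω, ∑' n, ENNReal.ofReal (((R n ω).mainEnergy / (n : ℝ) ^ 4) ^ 2) ∂P ≠ ⊤ := by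
    rw [lintegral_tsum fun n => (hmeas n).aemeasurable]
    exact ne_top_of_le_ne_top hsum.tsum_ofReal_ne_top
      (ENNReal.tsum_le_tsum fun n => (hR n).lintegral_mainEnergy_le)
  filter_upwards [ae_lt_top (Measurable.tsum hmeas) hfin] with ω hω
  have h1 := (ENNReal.tendsto_toReal ENNReal.zero_ne_top).comp
    (ENNReal.tendsto_atTop_zero_of_tsum_ne_top hω.ne)
  have h2 : Tendsto (fun n : ℕ => |(R n ω).mainEnergy / (n : ℝ) ^ 4|) atTop (𝓝 0) := by
    have := (Real.continuous_sqrt.tendsto 0).comp h1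
    rw [Real.sqrt_zero] at this
    refine this.congr fun n => ?_
    simp only [Function.comp_apply]
    rw [ENNReal.toReal_ofReal (sq_nonneg _), Real.sqrt_sq_eq_abs]
  have h3 : Tendsto (fun n : ℕ => |(R n ω).mainEnergy / (n : ℝ) ^ 4| + 2 / (n : ℝ)) atTop
      (𝓝 (0 + 0)) := h2.add (tendsto_natCast_atTop_atTop.const_div_atTop _)
  rw [add_zero] at h3
  refine convergesTo_phiQR_of_energy tendsto_id _ (squeeze_zero' (Eventually.of_forall fun n =>
    div_nonneg (energy_nonneg _) (by positivity)) ?_ h3)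
  filter_upwards [eventually_ge_atTop 1] with n hn
  have hn' : (0 : ℝ) < n := by exact_mod_cast hn
  have h4 := (R n ω).energy_le_mainEnergy_add
  have h5 := le_abs_self ((R n ω).mainEnergy / (n : ℝ) ^ 4)
  have h6 : ((R n ω).mainEnergy + 2 * (n : ℝ) ^ 3) / (n : ℝ) ^ 4 =
      (R n ω).mainEnergy / (n : ℝ) ^ 4 + 2 / (n : ℝ) := by
    field_simp
  calc (R n ω).energy / (n : ℝ) ^ 4 ≤ ((R n ω).mainEnergy + 2 * (n : ℝ) ^ 3) / (n : ℝ) ^ 4 :=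
        div_le_div_of_nonneg_right h4 (by positivity)
    _ ≤ _ := by rw [h6]; linarith

end Random

/-! ### The maximum density -/

lemma tendsto_max_density : ∃ m : ℕ → ℝ,
    (∀ n, IsGreatest (Set.range fun S : Tournament (Fin n) => T58.density S) (m n)) ∧
      Tendsto m atTop (𝓝 (15 / 128)) := by
  have hmax : ∀ n, ∃ m : ℝ,
      IsGreatest (Set.range fun S : Tournament (Fin n) => T58.density S) m := by
    intro n
    have : Nonempty (Tournament (Fin n)) := Fintype.card_pos_iff.1 card_tournament_pos
    exact (Set.finite_range _).isCompact.exists_isGreatest (Set.range_nonempty _)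
  choose m hm using hmax
  refine ⟨m, hm, ?_⟩
  choose S hS using exists_energy_le
  have hconv : ConvergesTo S phiQR := by
    refine convergesTo_phiQR_of_energy tendsto_id S (squeeze_zero' (g := fun n : ℕ =>
      2 / (n : ℝ) + 16 / (n : ℝ)) (Eventually.of_forall fun n =>
        div_nonneg (energy_nonneg _) (by positivity)) ?_ ?_)
    · filter_upwards [eventually_ge_atTop 1] with n hn
      have hn' : (1 : ℝ) ≤ n := by exact_mod_cast hn
      change (S n).energy / (n : ℝ) ^ 4 ≤ _
      rw [div_le_iff₀ (by positivity)]
      refine (hS n).trans ?_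
      have : (2 / (n : ℝ) + 16 / (n : ℝ)) * (n : ℝ) ^ 4 = 2 * (n : ℝ) ^ 3 + 16 * (n : ℝ) ^ 3 := by
        field_simp
      rw [this]
      have : (n : ℝ) ^ 2 ≤ (n : ℝ) ^ 3 := pow_le_pow_right₀ hn' (by norm_num)
      linarith
    · have := (tendsto_natCast_atTop_atTop (R := ℝ)).const_div_atTop (2 : ℝ) |>.add
        ((tendsto_natCast_atTop_atTop (R := ℝ)).const_div_atTop (16 : ℝ))
      rwa [add_zero] at this
  have hlow := hconv 5 T58
  rw [phiQR_T58] at hlow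
  have hup : Tendsto (fun n : ℕ => (15 / 128 + 1400 / n : ℝ)) atTop (𝓝 (15 / 128 + 0)) :=
    tendsto_const_nhds.add (tendsto_natCast_atTop_atTop.const_div_atTop _)
  rw [add_zero] at hup
  refine tendsto_of_tendsto_of_tendsto_of_le_of_le' hlow hup
    (Eventually.of_forall fun n => (hm n).2 ⟨S n, rfl⟩) ?_
  filter_upwards [eventually_ge_atTop 50] with n hn
  obtain ⟨T, hT⟩ := (hm n).1
  simp only at hT
  rw [← hT]
  have h := T.density_T58_le (by simpa using hn)
  have := T.energy_nonneg
  rw [Fintype.card_fin] at h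
  have : 0 ≤ 9 / 128 * (T.energy / (n : ℝ) ^ 4) := by positivity
  linarith

end Tournament

theorem theorem1 :
    -- the maximum density of `T₅⁸` in a tournament of size `n` tends to `15/128`
    (∃ m : ℕ → ℝ,
      (∀ n, IsGreatest
        (Set.range fun S : Tournament (Fin n) => Tournament.T58.density S) (m n)) ∧
      Tendsto m atTop (𝓝 (15 / 128))) ∧
    -- a sequence of increasing sizes attains it in the limit iff it converges to `φ_qr`
    (∀ (s : ℕ → ℕ), StrictMono s → ∀ T : ∀ n, Tournament (Fin (s n)),
      (Tendsto (fun n => Tournament.T58.density (T n)) atTop (𝓝 (15 / 128)) ↔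
        Tournament.ConvergesTo T Tournament.phiQR)) ∧
    -- the same for positive homomorphisms
    (∀ φ : ∀ k, Tournament (Fin k) → ℝ, Tournament.IsPosHom φ →
      φ 5 Tournament.T58 ≤ 15 / 128 ∧
        (φ 5 Tournament.T58 = 15 / 128 ↔ φ = Tournament.phiQR)) ∧
    -- `φ_qr` is the almost sure limit of the random tournaments `R_{n,1/2}`
    (∀ (Ω : Type*) [MeasurableSpace Ω] (P : Measure Ω) [IsProbabilityMeasure P]
      (R : ∀ n, Ω → Tournament (Fin n)), (∀ n, Tournament.IsRandomTournament P (R n)) →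
        ∀ᵐ ω ∂P, Tournament.ConvergesTo (fun n => R n ω) Tournament.phiQR) := by
  refine ⟨Tournament.tendsto_max_density, fun s hs T => ⟨fun h =>
    Tournament.convergesTo_phiQR_of_tendsto hs.tendsto_atTop T h, fun h => ?_⟩,
    fun φ hφ => ⟨hφ.map_T58_le, hφ.eq_phiQR, ?_⟩, fun Ω _ P _ R hR =>
    Tournament.ae_convergesTo_phiQR hR⟩
  · have := h 5 Tournament.T58
    rwa [Tournament.phiQR_T58] at this
  · rintro rfl
    exact Tournament.phiQR_T58
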